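/- Let $k,q>0$ be real numbers with $kq>2$, let $\gamma>0$, and put $\tilde b=kq(kq-2)$, $\tilde a=\gamma\,kq(kq-2)$, and $f(u)=\tilde a\,u^{1+\frac{2}{kq}}-\tilde b\,u$ for $u\ge 0$, extended to $u<0$ as an odd function. For $\alpha>0$ consider the initial value problem on $[0,\infty)$ $$u''+\coth\tau\;u'+f(u)=0\quad(\tau>0),\qquad u(0)=\alpha,\quad u'(0)=0 .$$ For every $\alpha>0$ it has exactly one solution $u(\alpha,\cdot)$ on $[0,\infty)$. Let $N$ be the set of $\alpha>0$ for which $u(\alpha,\cdot)$ has a zero in $(0,\infty)$; for $\alpha\in N$ let $b(\alpha)$ be its first zero. Let $G$ be the set of $\alpha>0$ for which $u(\alpha,\cdot)>0$ on $[0,\infty)$ and $\lim_{\tau\to\infty}u(\alpha,\tau)=0$. Let $w(\alpha,\tau)=\frac{\partial u}{\partial\alpha}(\alpha,\tau)$. Then every $\alpha\in G\cup N$ is strictly admissible, that is: (i) if $\alpha\in G$, then $w(\alpha,\tau)$ exists for all $\tau\ge 0$, $w(\alpha,\cdot)$ has exactly one zero in $(0,\infty)$, and $\lim_{\tau\to\infty}w(\alpha,\tau)=-\infty$;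 (ii) if $\alpha\in N$, then $w(\alpha,\tau)$ exists for all $\tau\in[0,b(\alpha)]$, $w(\alpha,\cdot)$ has exactly one zero in $(0,b(\alpha))$, and $w(\alpha,b(\alpha))<0$. Consequently the ground state is unique: any two solutions $u,v$ of $u''+\coth\tau\,u'+f(u)=0$ on $(0,\infty)$ that are positive on $[0,\infty)$, satisfy $u'(0)=v'(0)=0$ and tend to $0$ as $\tau\to\infty$ coincide on $[0,\infty)$. -/

import Mathlib

open Set Filter Topology

noncomputable section

/-- The nonlinearity `f(u) = ã u^{1 + 2/(kq)} - b̃ u`, with `b̃ = kq(kq-2)` and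
`ã = γ kq(kq-2)`. It is extended to `u < 0` as an odd function, so that it is `C¹` on the whole
real line; for `u ≥ 0` one has `|u|^{2/(kq)} u = u^{1 + 2/(kq)}`. -/
def nonlinearity (k q γ u : ℝ) : ℝ :=
  γ * (k * q * (k * q - 2)) * (|u| ^ (2 / (k * q)) * u) - k * q * (k * q - 2) * u

/-- `u` solves, on `[0, ∞)`, the initial value problem
`u'' + coth τ u' + f(u) = 0`, `u(0) = α`, `u'(0) = 0`.
The equation holds classically on `(0, ∞)`, and the derivative at `0` is one-sided. The values
of `u` at negative arguments play no role. -/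
structure IsRadialSolution (k q γ α : ℝ) (u : ℝ → ℝ) : Prop where
  init : u 0 = α
  deriv_init : HasDerivWithinAt u 0 (Ici 0) 0
  differentiable : ∀ τ : ℝ, 0 < τ → DifferentiableAt ℝ u τ
  equation : ∀ τ : ℝ, 0 < τ →
    HasDerivAt (deriv u)
      (-(Real.cosh τ / Real.sinh τ) * deriv u τ - nonlinearity k q γ (u τ)) τ

/-- `U α` is, for every `α > 0`, the solution with initial value `α`. -/
def IsSolutionFamily (k q γ : ℝ) (U : ℝ → ℝ → ℝ) : Prop :=
  ∀ α : ℝ, 0 < α → IsRadialSolution k q γ α (U α)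

/-- The set `N` of the initial values whose solution has a zero at some finite `τ`. -/
def zeroSet (U : ℝ → ℝ → ℝ) : Set ℝ :=
  {α | 0 < α ∧ ∃ τ : ℝ, 0 < τ ∧ U α τ = 0}

/-- The set `G` of the initial values whose solution is positive and decays to zero. -/
def groundSet (U : ℝ → ℝ → ℝ) : Set ℝ :=
  {α | 0 < α ∧ (∀ τ : ℝ, 0 ≤ τ → 0 < U α τ) ∧ Tendsto (U α) atTop (𝓝 0)}

/-- `b` is the first zero of `u` in `(0, ∞)`, and `u` is positive before it. -/
def IsFirstZero (u : ℝ → ℝ) (b : ℝ) : Prop :=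
  0 < b ∧ u b = 0 ∧ ∀ τ : ℝ, 0 ≤ τ → τ < b → 0 < u τ

/-- On the set `I`, the function `w` is the variation `w(τ) = ∂u/∂α (α, τ)` of the family. -/
def IsVariation (U : ℝ → ℝ → ℝ) (α : ℝ) (I : Set ℝ) (w : ℝ → ℝ) : Prop :=
  ∀ τ ∈ I, HasDerivAt (fun a => U a τ) (w τ) α

/-- Strict admissibility of an initial value in `G`: the variation has exactly one zero in
`(0, ∞)` and tends to `-∞`. -/
def StrictlyAdmissibleGround (U : ℝ → ℝ → ℝ) (α : ℝ) : Prop :=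
  ∃ w : ℝ → ℝ, IsVariation U α (Ici 0) w ∧
    (∃! τ : ℝ, τ ∈ Ioi 0 ∧ w τ = 0) ∧ Tendsto w atTop atBot

/-- Strict admissibility of an initial value in `N`: with `b` the zero of the solution, the
variation has exactly one zero in `(0, b)` and is negative at `b`. -/
def StrictlyAdmissibleZero (U : ℝ → ℝ → ℝ) (α : ℝ) : Prop :=
  ∃ b : ℝ, IsFirstZero (U α) b ∧ ∃ w : ℝ → ℝ, IsVariation U α (Icc 0 b) w ∧
    (∃! τ : ℝ, τ ∈ Ioo 0 b ∧ w τ = 0) ∧ w b < 0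

/-- A ground state: a solution, for some positive initial value, which is positive on `[0, ∞)`
and decays to zero at infinity. -/
def IsGroundState (k q γ : ℝ) (u : ℝ → ℝ) : Prop :=
  (∃ α : ℝ, 0 < α ∧ IsRadialSolution k q γ α u) ∧
    (∀ τ : ℝ, 0 ≤ τ → 0 < u τ) ∧ Tendsto u atTop (𝓝 0)

end

/-! Write f(u) = A|u|^ε u - Bu with ε = 2/(kq), p = u', r = w'. The variation w solves the
linearized equation with w(0) = 1, w'(0) = 0. Everything rests on the sign of the Wronskian Δ = pw -
ur: since (w/u)' = -Δ/u², positivity of Δ while u > 0 leaves w at most one zero.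

The sign comes from a generalized Pohozaev function J (`pohozaev`), weighted by a power of sinh so
that J' is a negative multiple of u². Its value at the first zero of u, or a lower bound for it
tending to 0 at infinity, is nonnegative, hence J > 0 before. The companion Y = 2(w/u)J - DJ[w]
(`pohozaevVariation`) has Y(0) = 0 and Y' = -2ΔJ/u². So Y < 0 as long as Δ > 0. At a first zero of
Δ, Y < 0 would force w > 0; but (sinh · Δ)' has the sign of w, so sinh · Δ would be increasing just
before it vanishes, which is absurd (`RadialPair.wronskian_pos`).

At a first zero b of u, Δ(b) = 0 would give Y → 0, impossible for a strictly decreasing Y starting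
at 0. Hence Δ(b) = p(b)w(b) > 0 with p(b) ≤ 0, so w(b) < 0. For a ground state, u and p decay like
1/sinh; if w stayed positive, w/u would decrease at least linearly. After its zero, w is negative,
and the linear equation drives it to -∞ unless w → 0, which Y again excludes.

Uniqueness follows by shooting. Just above a ground-state value α, divergence of w produces
solutions that reach 0 (`eventually_exists_nonpos`). Since w(b) < 0, reaching 0 by a fixed time
persists as the initial value increases, so no larger value gives a ground state
(`not_pos_of_ground_lt`). -/

/-! ### Monotonicity and first zeros. -/

theorem le_of_hasDerivAt_nonneg {g g' : ℝ → ℝ} {a b : ℝ} (hab : a ≤ b)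
    (hc : ContinuousOn g (Icc a b)) (hd : ∀ x ∈ Ioo a b, HasDerivAt g (g' x) x)
    (h : ∀ x ∈ Ioo a b, 0 ≤ g' x) : g a ≤ g b := by
  refine monotoneOn_of_deriv_nonneg (convex_Icc a b) hc ?_ ?_ (left_mem_Icc.2 hab)
    (right_mem_Icc.2 hab) hab
  · rw [interior_Icc]
    exact fun x hx => (hd x hx).differentiableAt.differentiableWithinAt
  · rw [interior_Icc]
    intro x hx
    rw [(hd x hx).deriv]
    exact h x hx

theorem lt_of_hasDerivAt_pos {g g' : ℝ → ℝ} {a b : ℝ} (hab : a < b)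
    (hc : ContinuousOn g (Icc a b)) (hd : ∀ x ∈ Ioo a b, HasDerivAt g (g' x) x)
    (h : ∀ x ∈ Ioo a b, 0 < g' x) : g a < g b := by
  refine strictMonoOn_of_deriv_pos (convex_Icc a b) hc ?_ (left_mem_Icc.2 hab.le)
    (right_mem_Icc.2 hab.le) hab
  rw [interior_Icc]
  intro x hx
  rw [(hd x hx).deriv]
  exact h x hx

/-- A function which is positive at `a` and nonpositive at `b` has a first zero in `(a, b]`. -/
theorem exists_first_zero {g : ℝ → ℝ} {a b : ℝ} (hab : a ≤ b) (hg : ContinuousOn g (Icc a b))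
    (ha : 0 < g a) (hb : g b ≤ 0) : ∃ e ∈ Ioc a b, g e = 0 ∧ ∀ x ∈ Ico a e, 0 < g x := by
  have hcl : IsCompact (Icc a b ∩ g ⁻¹' Iic 0) :=
    isCompact_Icc.of_isClosed_subset (hg.preimage_isClosed_of_isClosed isClosed_Icc isClosed_Iic)
      inter_subset_left
  obtain ⟨e, ⟨heI, hge⟩, hmin⟩ := hcl.exists_isLeast ⟨b, right_mem_Icc.2 hab, hb⟩
  have hpos : ∀ x ∈ Ico a e, 0 < g x := by
    intro x hx
    by_contra hcon
    exact absurd (hmin ⟨⟨hx.1, hx.2.le.trans heI.2⟩, not_lt.1 hcon⟩) (not_le.2 hx.2)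
  have hae : a < e := by
    rcases heI.1.eq_or_lt with h | h
    · rw [← h] at hge; exact absurd ha (not_lt.2 hge)
    · exact h
  refine ⟨e, ⟨hae, heI.2⟩, le_antisymm hge ?_, hpos⟩
  have hcw : Tendsto g (𝓝[Ico a e] e) (𝓝 (g e)) :=
    (hg e heI).mono_left (nhdsWithin_mono _ fun x hx => ⟨hx.1, hx.2.le.trans heI.2⟩)
  have : (𝓝[Ico a e] e).NeBot := by
    rw [← mem_closure_iff_nhdsWithin_neBot, closure_Ico hae.ne]
    exact right_mem_Icc.2 hae.le
  exact ge_of_tendsto hcw (eventually_nhdsWithin_of_forall fun x hx => (hpos x hx).le)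

/-! ### Radial equations with a source term, and their energy estimate. -/

/-- `y'' + coth y' + h = 0` on `(0, ∞)` with `y'(0) = 0`, where `p = y'`. -/
structure RadialPair (y p h : ℝ → ℝ) : Prop where
  continuousOn_fst : ContinuousOn y (Ici 0)
  continuousOn_snd : ContinuousOn p (Ici 0)
  snd_zero : p 0 = 0
  hasDerivAt_fst : ∀ τ : ℝ, 0 < τ → HasDerivAt y (p τ) τ
  hasDerivAt_snd : ∀ τ : ℝ, 0 < τ →
    HasDerivAt p (-(Real.cosh τ / Real.sinh τ) * p τ - h τ) τ

namespace RadialPair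

variable {y p h y₂ p₂ h₂ : ℝ → ℝ}

theorem congr_right (H : RadialPair y p h) (hh : ∀ τ, 0 < τ → h τ = h₂ τ) :
    RadialPair y p h₂ :=
  ⟨H.1, H.2, H.3, H.4, fun τ hτ => hh τ hτ ▸ H.5 τ hτ⟩

theorem sub (H : RadialPair y p h) (H₂ : RadialPair y₂ p₂ h₂) :
    RadialPair (fun τ => y τ - y₂ τ) (fun τ => p τ - p₂ τ) (fun τ => h τ - h₂ τ) := by
  refine ⟨H.1.sub H₂.1, H.2.sub H₂.2, by simp [H.3, H₂.3], fun τ hτ => (H.4 τ hτ).sub (H₂.4 τ hτ),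
    fun τ hτ => ?_⟩
  exact HasDerivAt.congr_deriv ((H.5 τ hτ).sub (H₂.5 τ hτ)) (by ring)

theorem const_mul (H : RadialPair y p h) (c : ℝ) :
    RadialPair (fun τ => c * y τ) (fun τ => c * p τ) (fun τ => c * h τ) := by
  refine ⟨continuousOn_const.mul H.1, continuousOn_const.mul H.2, by simp [H.3],
    fun τ hτ => (H.4 τ hτ).const_mul c, fun τ hτ => ?_⟩
  exact HasDerivAt.congr_deriv ((H.5 τ hτ).const_mul c) (by ring)

theorem hasDerivAt_sinh_mul (H : RadialPair y p h) {τ : ℝ} (hτ : 0 < τ) :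
    HasDerivAt (fun t => Real.sinh t * p t) (-(Real.sinh τ * h τ)) τ := by
  have hs : Real.sinh τ ≠ 0 := (Real.sinh_pos_iff.2 hτ).ne'
  refine HasDerivAt.congr_deriv ((Real.hasDerivAt_sinh τ).mul (H.5 τ hτ)) ?_
  field_simp
  ring

theorem continuousOn_sinh_mul (H : RadialPair y p h) :
    ContinuousOn (fun t => Real.sinh t * p t) (Ici 0) :=
  Real.continuous_sinh.continuousOn.mul H.2

/-- Gronwall estimate for the energy `y² + y'²`; the singular term is dissipative. -/
theorem energy_le (H : RadialPair y p h) {K η T : ℝ} (hK : 0 ≤ K)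
    (hh : ∀ τ ∈ Ioo 0 T, |h τ| ≤ K * |y τ| + η) {τ : ℝ} (hτ : τ ∈ Icc 0 T) :
    y τ ^ 2 + p τ ^ 2 ≤ Real.exp ((K + 2) * T) * (y 0 ^ 2 + η ^ 2 * T) := by
  -- The rate K + 2 collects 1 from 2yp, K from 2K|p||y| and 1 from 2|p|η ≤ p² + η²; the remaining
  -- η² is paid by the linear term.
  set g : ℝ → ℝ := fun t => η ^ 2 * t - Real.exp (-((K + 2) * t)) * (y t ^ 2 + p t ^ 2) with hg
  set g' : ℝ → ℝ := fun t => η ^ 2 - (Real.exp (-((K + 2) * t)) * (-(K + 2)) *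
    (y t ^ 2 + p t ^ 2) + Real.exp (-((K + 2) * t)) * (2 * y t * p t +
      2 * p t * (-(Real.cosh t / Real.sinh t) * p t - h t))) with hg'
  have hmono : g 0 ≤ g τ := by
    refine le_of_hasDerivAt_nonneg (g' := g') hτ.1 ?_ ?_ ?_
    · have h1 : ContinuousOn y (Icc 0 τ) := H.1.mono Icc_subset_Ici_self
      have h2 : ContinuousOn p (Icc 0 τ) := H.2.mono Icc_subset_Ici_self
      simp only [hg]
      fun_prop
    · intro x hx
      have h1 := H.4 x hx.1
      have h2 := H.5 x hx.1
      have h3 : HasDerivAt (fun t : ℝ => Real.exp (-((K + 2) * t)))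
          (Real.exp (-((K + 2) * x)) * (-(K + 2))) x := by
        have := (((hasDerivAt_id x).const_mul (K + 2)).neg).exp
        simpa using this
      refine HasDerivAt.congr_deriv
        (((hasDerivAt_id x).const_mul (η ^ 2)).sub (h3.mul ((h1.pow 2).add (h2.pow 2)))) ?_
      simp only [hg']
      push_cast
      ring
    · intro x hx
      have hx' : x ∈ Ioo 0 T := ⟨hx.1, hx.2.trans_le hτ.2⟩
      have hb := hh x hx'
      have hs : 0 < Real.cosh x / Real.sinh x :=
        div_pos (Real.cosh_pos x) (Real.sinh_pos_iff.2 hx.1)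
      have he1 : Real.exp (-((K + 2) * x)) ≤ 1 := by
        rw [Real.exp_le_one_iff]
        have := hx.1
        nlinarith
      have he0 : 0 < Real.exp (-((K + 2) * x)) := Real.exp_pos _
      have hη : 2 * y x * p x + 2 * p x * (-(Real.cosh x / Real.sinh x) * p x - h x) ≤
          (K + 2) * (y x ^ 2 + p x ^ 2) + η ^ 2 := by
        have e1 : -(p x * h x) ≤ |p x| * (K * |y x| + η) := by
          calc -(p x * h x) ≤ |p x * h x| := neg_le_abs _
            _ = |p x| * |h x| := abs_mul _ _
            _ ≤ _ := by gcongr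
        have e2 : 2 * y x * p x ≤ y x ^ 2 + p x ^ 2 := two_mul_le_add_sq _ _
        have e3 : 2 * |p x| * |y x| ≤ p x ^ 2 + y x ^ 2 := by
          rw [← sq_abs (p x), ← sq_abs (y x)]; exact two_mul_le_add_sq _ _
        have e4 : 2 * |p x| * η ≤ p x ^ 2 + η ^ 2 := by
          rw [← sq_abs (p x)]; exact two_mul_le_add_sq _ _
        have e5 : 0 ≤ (Real.cosh x / Real.sinh x) * p x ^ 2 := by positivity
        have e6 := mul_le_mul_of_nonneg_left e3 hK
        nlinarith [sq_nonneg (y x)]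
      have := mul_le_mul_of_nonneg_left hη he0.le
      have h7 := mul_le_mul_of_nonneg_right he1 (sq_nonneg η)
      simp only [hg']
      nlinarith
  simp only [hg, H.3] at hmono
  simp at hmono
  have hE : Real.exp ((K + 2) * τ) * Real.exp (-((K + 2) * τ)) = 1 := by
    rw [← Real.exp_add]; simp
  have h8 : Real.exp (-((K + 2) * τ)) * (y τ ^ 2 + p τ ^ 2) ≤ y 0 ^ 2 + η ^ 2 * T := by
    have := mul_le_mul_of_nonneg_left hτ.2 (sq_nonneg η)
    nlinarith
  calc y τ ^ 2 + p τ ^ 2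
      = Real.exp ((K + 2) * τ) * (Real.exp (-((K + 2) * τ)) * (y τ ^ 2 + p τ ^ 2)) := by
        rw [← mul_assoc, hE, one_mul]
    _ ≤ Real.exp ((K + 2) * τ) * (y 0 ^ 2 + η ^ 2 * T) := by gcongr
    _ ≤ _ := by
        have hT : 0 ≤ T := hτ.1.trans hτ.2
        have : τ ≤ T := hτ.2
        gcongr

end RadialPair

/-! ### Existence for globally Lipschitz right-hand sides -/

/-- The bounded inverse of `q ↦ q' + coth q`. -/
noncomputable def sinhAverage (h : ℝ → ℝ) (t : ℝ) : ℝ :=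
  (Real.sinh t)⁻¹ * ∫ x in (0 : ℝ)..t, Real.sinh x * h x

theorem sinhAverage_zero (h : ℝ → ℝ) : sinhAverage h 0 = 0 := by simp [sinhAverage]

theorem hasDerivAt_sinhAverage {h : ℝ → ℝ} (hh : Continuous h) {t : ℝ} (ht : t ≠ 0) :
    HasDerivAt (sinhAverage h) (h t - Real.cosh t / Real.sinh t * sinhAverage h t) t := by
  have hs : Real.sinh t ≠ 0 := by simpa [Real.sinh_eq_zero] using ht
  have h1 : HasDerivAt (fun t => ∫ x in (0 : ℝ)..t, Real.sinh x * h x) (Real.sinh t * h t) t :=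
    (Real.continuous_sinh.mul hh).integral_hasStrictDerivAt 0 t |>.hasDerivAt
  refine HasDerivAt.congr_deriv (((Real.hasDerivAt_sinh t).inv hs).mul h1) ?_
  simp only [sinhAverage, Pi.inv_apply]
  field_simp
  ring

/-- Only t = 0 needs care: |sinh x| ≤ |sinh t| for x between 0 and t, so the factor 1/sinh t cancels
and the average is O(|t|). -/
theorem continuous_sinhAverage {h : ℝ → ℝ} (hh : Continuous h) : Continuous (sinhAverage h) := by
  rw [continuous_iff_continuousAt]
  intro t
  by_cases ht : t = 0
  · subst ht
    obtain ⟨C, hC⟩ := isCompact_Icc.exists_bound_of_continuousOn (s := Icc (-1 : ℝ) 1) hh.continuousOn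
    rw [ContinuousAt, sinhAverage_zero]
    have hb : ∀ᶠ t : ℝ in 𝓝 0, ‖sinhAverage h t‖ ≤ C * |t| := by
      filter_upwards [Icc_mem_nhds (show (-1 : ℝ) < 0 by norm_num) (show (0 : ℝ) < 1 by norm_num)]
        with t ht
      have hC0 : 0 ≤ C := (norm_nonneg _).trans (hC t ht)
      by_cases h0 : t = 0
      · subst h0; simp [sinhAverage_zero]
      have hs : 0 < |Real.sinh t| := abs_pos.2 (by simpa [Real.sinh_eq_zero] using h0)
      have h2 : ‖∫ x in (0 : ℝ)..t, Real.sinh x * h x‖ ≤ |Real.sinh t| * C * |t - 0| := by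
        refine intervalIntegral.norm_integral_le_of_norm_le_const fun x hx => ?_
        have hx1 : |x| ≤ |t| := by
          rcases le_total 0 t with h | h
          · rw [uIoc_of_le h] at hx
            rw [abs_of_pos hx.1, abs_of_nonneg h]; exact hx.2
          · rw [uIoc_of_ge h] at hx
            rw [abs_of_nonpos hx.2, abs_of_nonpos h]; linarith [hx.1]
        rw [norm_mul, Real.norm_eq_abs]
        have hx2 : x ∈ Icc (-1 : ℝ) 1 := abs_le.1 (hx1.trans (abs_le.2 ht))
        refine mul_le_mul ?_ (hC x hx2) (norm_nonneg _) (abs_nonneg _)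
        rw [Real.abs_sinh, Real.abs_sinh]
        exact Real.sinh_le_sinh.2 hx1
      rw [sinhAverage, norm_mul, norm_inv, Real.norm_eq_abs (Real.sinh t)]
      calc _ ≤ |Real.sinh t|⁻¹ * (|Real.sinh t| * C * |t - 0|) := by gcongr
        _ = _ := by rw [sub_zero]; field_simp
    refine squeeze_zero_norm' hb ?_
    have : Continuous fun t : ℝ => C * |t| := by fun_prop
    simpa using this.tendsto 0
  · exact (hasDerivAt_sinhAverage hh ht).continuousAt

theorem sinhAverage_sub {h₁ h₂ : ℝ → ℝ} (h1 : Continuous h₁) (h2 : Continuous h₂) (t : ℝ) :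
    sinhAverage (fun x => h₁ x - h₂ x) t = sinhAverage h₁ t - sinhAverage h₂ t := by
  simp only [sinhAverage, mul_sub]
  rw [intervalIntegral.integral_sub
    (Continuous.intervalIntegrable (by fun_prop) _ _)
    (Continuous.intervalIntegrable (by fun_prop) _ _)]
  ring

theorem integral_exp_mul_le {L t : ℝ} (hL : 0 < L) :
    ∫ x in (0 : ℝ)..t, Real.exp (L * x) ≤ Real.exp (L * t) / L := by
  have : ∫ x in (0 : ℝ)..t, Real.exp (L * x) = (Real.exp (L * t) - 1) / L := by
    rw [intervalIntegral.integral_comp_mul_left (fun x => Real.exp x) hL.ne', integral_exp]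
    simp
    ring
  rw [this]
  gcongr
  linarith

theorem abs_sinhAverage_le {h : ℝ → ℝ} {c L : ℝ} (hc : 0 ≤ c) (hL : 0 < L)
    (hb : ∀ x, 0 ≤ x → |h x| ≤ c * Real.exp (L * x)) {t : ℝ} (ht : 0 ≤ t) :
    |sinhAverage h t| ≤ c / L * Real.exp (L * t) := by
  rcases ht.eq_or_lt with h0 | h0
  · rw [← h0, sinhAverage_zero]; simp; positivity
  have hs := Real.sinh_pos_iff.2 h0
  have h1 : ‖∫ x in (0 : ℝ)..t, Real.sinh x * h x‖ ≤
      ∫ x in (0 : ℝ)..t, Real.sinh t * c * Real.exp (L * x) := by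
    refine intervalIntegral.norm_integral_le_of_norm_le ht (Eventually.of_forall fun x hx => ?_)
      (Continuous.intervalIntegrable (by fun_prop) _ _)
    rw [norm_mul, Real.norm_eq_abs, Real.norm_eq_abs, abs_of_pos (Real.sinh_pos_iff.2 hx.1),
      mul_assoc]
    gcongr
    · exact Real.sinh_le_sinh.2 hx.2
    · exact hb x hx.1.le
  rw [intervalIntegral.integral_const_mul] at h1
  have h2 := integral_exp_mul_le (t := t) hL
  rw [sinhAverage, abs_mul, abs_inv, abs_of_pos hs]
  calc (Real.sinh t)⁻¹ * |∫ x in (0 : ℝ)..t, Real.sinh x * h x|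
      ≤ (Real.sinh t)⁻¹ * (Real.sinh t * c * (Real.exp (L * t) / L)) := by
        gcongr
        refine h1.trans ?_
        gcongr
    _ = _ := by field_simp

theorem abs_integral_sinhAverage_le {h : ℝ → ℝ} {c L : ℝ} (hc : 0 ≤ c)
    (hL : 0 < L) (hb : ∀ x, 0 ≤ x → |h x| ≤ c * Real.exp (L * x)) {t : ℝ} (ht : 0 ≤ t) :
    |∫ x in (0 : ℝ)..t, sinhAverage h x| ≤ c / L ^ 2 * Real.exp (L * t) := by
  have h1 : ‖∫ x in (0 : ℝ)..t, sinhAverage h x‖ ≤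
      ∫ x in (0 : ℝ)..t, c / L * Real.exp (L * x) :=
    intervalIntegral.norm_integral_le_of_norm_le ht
      (Eventually.of_forall fun x hx => abs_sinhAverage_le hc hL hb hx.1.le)
      (Continuous.intervalIntegrable (by fun_prop) _ _)
  rw [intervalIntegral.integral_const_mul] at h1
  have h2 := integral_exp_mul_le (t := t) hL
  calc _ ≤ c / L * (Real.exp (L * t) / L) := h1.trans (by gcongr)
    _ = _ := by field_simp

/-- Picard iteration for y = α - ∫ `sinhAverage` in the norm weighted by exp(-Lτ), which reaches all
of [0, ∞) at once. Averaging and integrating each gain a factor 1/L against exp(Lτ), so the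
Lipschitz constant is K/L², below 1/2 for L = K + 1. -/
theorem exists_radialPair (F : ℝ → ℝ → ℝ) (hF : Continuous fun z : ℝ × ℝ => F z.1 z.2) {K C : ℝ}
    (hK : 0 ≤ K) (hLip : ∀ x y z, |F x y - F x z| ≤ K * |y - z|) (hC : ∀ x, |F x 0| ≤ C) (α : ℝ) :
    ∃ y p, RadialPair y p (fun x => F x (y x)) ∧ y 0 = α := by
  classical
  set L : ℝ := K + 1 with hLdef
  have hL : 0 < L := by positivity
  have hC0 : 0 ≤ C := (abs_nonneg _).trans (hC 0)
  -- The unknown is v = exp(-Lτ) y; `max x 0` only extends it continuously to negative arguments.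
  let R : BoundedContinuousFunction ℝ ℝ → ℝ → ℝ :=
    fun v x => F x (Real.exp (L * max x 0) * v x)
  have hR : ∀ v, Continuous (R v) := by
    intro v
    have hv : Continuous v := v.continuous
    have : Continuous fun x : ℝ => (x, Real.exp (L * max x 0) * v x) := by fun_prop
    exact hF.comp this
  have hRd : ∀ v₁ v₂ : BoundedContinuousFunction ℝ ℝ, ∀ x, 0 ≤ x →
      |R v₁ x - R v₂ x| ≤ K * dist v₁ v₂ * Real.exp (L * x) := by
    intro v₁ v₂ x hx
    refine (hLip _ _ _).trans ?_
    rw [max_eq_left hx, ← mul_sub, abs_mul, abs_of_pos (Real.exp_pos _)]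
    have := BoundedContinuousFunction.dist_coe_le_dist (f := v₁) (g := v₂) x
    rw [Real.dist_eq] at this
    calc K * (Real.exp (L * x) * |v₁ x - v₂ x|) ≤ K * (Real.exp (L * x) * dist v₁ v₂) := by gcongr
      _ = _ := by ring
  have hRb : ∀ v : BoundedContinuousFunction ℝ ℝ, ∀ x, 0 ≤ x →
      |R v x| ≤ (C + K * ‖v‖) * Real.exp (L * x) := by
    intro v x hx
    have h1 := hRd v 0 x hx
    have h2 : R 0 x = F x 0 := by simp [R]
    rw [h2, dist_zero_right] at h1
    have h3 := abs_sub_abs_le_abs_sub (R v x) (F x 0)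
    have h4 := hC x
    have h5 : 1 ≤ Real.exp (L * x) := Real.one_le_exp (by positivity)
    nlinarith
  let Φ : (ℝ → ℝ) → ℝ → ℝ := fun h τ =>
    Real.exp (-(L * max τ 0)) * (α - ∫ x in (0 : ℝ)..(max τ 0), sinhAverage h x)
  have hder : ∀ h, Continuous h → ∀ τ,
      HasDerivAt (fun t => ∫ x in (0 : ℝ)..t, sinhAverage h x) (sinhAverage h τ) τ := fun h hh τ =>
    (continuous_sinhAverage hh).integral_hasStrictDerivAt 0 τ |>.hasDerivAt
  have hΦc : ∀ h, Continuous h → Continuous (Φ h) := by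
    intro h hh
    have h1 : Continuous fun t => ∫ x in (0 : ℝ)..t, sinhAverage h x :=
      continuous_iff_continuousAt.2 fun t => (hder h hh t).continuousAt
    have h2 : Continuous fun τ : ℝ => ∫ x in (0 : ℝ)..(max τ 0), sinhAverage h x :=
      h1.comp (by fun_prop : Continuous fun τ : ℝ => max τ 0)
    simp only [Φ]
    fun_prop
  have hmul : ∀ (c τ : ℝ), Real.exp (-(L * τ)) * (c * Real.exp (L * τ)) = c := by
    intro c τ
    have : Real.exp (-(L * τ)) * Real.exp (L * τ) = 1 := by rw [← Real.exp_add]; simp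
    linear_combination c * this
  have hΦb : ∀ v : BoundedContinuousFunction ℝ ℝ, ∀ τ,
      ‖Φ (R v) τ‖ ≤ |α| + (C + K * ‖v‖) / L ^ 2 := by
    intro v τ
    have hm : 0 ≤ max τ 0 := le_max_right _ _
    have h1 := abs_integral_sinhAverage_le (by positivity) hL (hRb v) hm
    have h2 : Real.exp (-(L * max τ 0)) ≤ 1 := by
      rw [Real.exp_le_one_iff]; nlinarith
    rw [Real.norm_eq_abs, abs_mul, abs_of_pos (Real.exp_pos _)]
    calc _ ≤ Real.exp (-(L * max τ 0)) *
          (|α| + (C + K * ‖v‖) / L ^ 2 * Real.exp (L * max τ 0)) := by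
          gcongr
          exact (abs_sub _ _).trans (by gcongr)
      _ = Real.exp (-(L * max τ 0)) * |α| + (C + K * ‖v‖) / L ^ 2 := by rw [mul_add, hmul]
      _ ≤ _ := by
          have := mul_le_mul_of_nonneg_right h2 (abs_nonneg α)
          linarith
  let S : BoundedContinuousFunction ℝ ℝ → BoundedContinuousFunction ℝ ℝ := fun v =>
    BoundedContinuousFunction.ofNormedAddCommGroup (Φ (R v)) (hΦc _ (hR v)) _ (hΦb v)
  have hS : ContractingWith (1 / 2) S := by
    refine ⟨by rw [← NNReal.coe_lt_coe]; norm_num, LipschitzWith.of_dist_le_mul fun v₁ v₂ => ?_⟩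
    rw [BoundedContinuousFunction.dist_le (by positivity)]
    intro τ
    have hm : 0 ≤ max τ 0 := le_max_right _ _
    have h1 := abs_integral_sinhAverage_le (by positivity) hL (hRd v₁ v₂) hm
    have h2 : ∫ x in (0 : ℝ)..(max τ 0), sinhAverage (fun x => R v₁ x - R v₂ x) x =
        (∫ x in (0 : ℝ)..(max τ 0), sinhAverage (R v₁) x) -
          ∫ x in (0 : ℝ)..(max τ 0), sinhAverage (R v₂) x := by
      rw [← intervalIntegral.integral_sub
        ((continuous_sinhAverage (hR v₁)).intervalIntegrable _ _)
        ((continuous_sinhAverage (hR v₂)).intervalIntegrable _ _)]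
      congr 1
      ext x
      exact sinhAverage_sub (hR v₁) (hR v₂) x
    rw [h2] at h1
    change dist (Φ (R v₁) τ) (Φ (R v₂) τ) ≤ _
    rw [Real.dist_eq]
    simp only [Φ]
    rw [← mul_sub, abs_mul, abs_of_pos (Real.exp_pos _), sub_sub_sub_cancel_left, abs_sub_comm]
    calc _ ≤ Real.exp (-(L * max τ 0)) *
          (K * dist v₁ v₂ / L ^ 2 * Real.exp (L * max τ 0)) := by gcongr
      _ = K / L ^ 2 * dist v₁ v₂ := by rw [hmul]; ring
      _ ≤ _ := by
          gcongr
          push_cast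
          rw [div_le_iff₀ (by positivity)]
          nlinarith [sq_nonneg K]
  obtain ⟨v, hv⟩ : ∃ v, S v = v := ⟨_, hS.fixedPoint_isFixedPt⟩
  have hvv : ∀ τ, v τ = Φ (R v) τ := fun τ => by
    conv_lhs => rw [← hv]
    rfl
  have key : ∀ τ, 0 ≤ τ → Real.exp (L * max τ 0) * v τ =
      α - ∫ x in (0 : ℝ)..τ, sinhAverage (R v) x := by
    intro τ hτ
    rw [hvv τ]
    simp only [Φ]
    rw [← mul_assoc, ← Real.exp_add, max_eq_left hτ]
    simp
  refine ⟨fun τ => α - ∫ x in (0 : ℝ)..τ, sinhAverage (R v) x, fun τ => -sinhAverage (R v) τ,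
    ⟨?_, ?_, ?_, ?_, ?_⟩, by simp⟩
  · exact fun τ _ => ((hder _ (hR v) τ).const_sub α).continuousAt.continuousWithinAt
  · exact (continuous_sinhAverage (hR v)).neg.continuousOn
  · simp [sinhAverage_zero]
  · exact fun τ _ => (hder _ (hR v) τ).const_sub α
  · intro τ hτ
    refine HasDerivAt.congr_deriv (hasDerivAt_sinhAverage (hR v) hτ.ne').neg ?_
    beta_reduce
    rw [← key τ hτ.le]
    simp only [R]
    ring

/-! ### The nonlinearity -/

/-- `f(x) = A |x| ^ ε x - B x`. -/
noncomputable def powerNl (A B ε x : ℝ) : ℝ := A * (|x| ^ ε * x) - B * x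

/-- The derivative of `powerNl`. -/
noncomputable def powerNlDeriv (A B ε x : ℝ) : ℝ := A * (1 + ε) * |x| ^ ε - B

/-- The primitive of `powerNl` which vanishes at `0`. -/
noncomputable def powerPot (A B ε x : ℝ) : ℝ := A / (2 + ε) * |x| ^ (2 + ε) - B / 2 * x ^ 2

section Nonlinearity

variable {A B ε : ℝ}

theorem hasDerivAt_powerPot (hε : 0 < ε) (x : ℝ) :
    HasDerivAt (powerPot A B ε) (powerNl A B ε x) x := by
  have h1 := (hasDerivAt_abs_rpow x (show (1 : ℝ) < 2 + ε by linarith)).const_mul (A / (2 + ε))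
  have h2 := ((hasDerivAt_id x).pow 2).const_mul (B / 2)
  refine HasDerivAt.congr_deriv (h1.sub h2) ?_
  have h3 : 2 + ε - 2 = ε := by ring
  rw [h3, powerNl]
  have : 2 + ε ≠ 0 := by positivity
  simp
  field_simp

theorem hasDerivAt_powerNl (hε : 0 < ε) (x : ℝ) :
    HasDerivAt (powerNl A B ε) (powerNlDeriv A B ε x) x := by
  suffices h : HasDerivAt (fun x : ℝ => |x| ^ ε * x) ((1 + ε) * |x| ^ ε) x by
    refine HasDerivAt.congr_deriv ((h.const_mul A).sub ((hasDerivAt_id x).const_mul B)) ?_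
    rw [powerNlDeriv]
    ring
  have key : ∀ c : ℝ, |c| = 1 → 0 < c * x →
      HasDerivAt (fun x : ℝ => |x| ^ ε * x) ((1 + ε) * |x| ^ ε) x := by
    intro c hc hx
    have hx0 : x ≠ 0 := by rintro rfl; simp at hx
    have habs : ∀ y, 0 < c * y → |y| = c * y := fun y hy => by
      rw [← abs_of_pos hy, abs_mul, hc, one_mul]
    have h1 : HasDerivAt (fun y : ℝ => (c * y) ^ ε * y)
        ((c * 1 * ε * (c * x) ^ (ε - 1)) * x + (c * x) ^ ε * 1) x :=
      (((hasDerivAt_id x).const_mul c).rpow_const (Or.inl hx.ne')).mul (hasDerivAt_id x)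
    have h2 : (fun x : ℝ => |x| ^ ε * x) =ᶠ[𝓝 x] fun y : ℝ => (c * y) ^ ε * y := by
      have : ∀ᶠ y in 𝓝 x, 0 < c * y :=
        (continuous_const.mul continuous_id).continuousAt.eventually (lt_mem_nhds hx)
      filter_upwards [this] with y hy
      rw [habs y hy]
    refine HasDerivAt.congr_deriv (h1.congr_of_eventuallyEq h2) ?_
    have h3 : (c * x) ^ ε = (c * x) ^ (ε - 1) * (c * x) := by
      rw [← Real.rpow_add_one hx.ne']; ring_nf
    rw [habs x hx, h3]
    ring
  rcases lt_trichotomy x 0 with hx | hx | hx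
  · exact key (-1) (by simp) (by linarith)
  · subst hx
    rw [hasDerivAt_iff_tendsto_slope]
    have hc : Continuous fun y : ℝ => |y| ^ ε := continuous_abs.rpow_const fun _ => Or.inr hε.le
    have h1 : Tendsto (fun y : ℝ => |y| ^ ε) (𝓝[≠] 0) (𝓝 ((1 + ε) * |0| ^ ε)) := by
      have := (hc.tendsto 0).mono_left (nhdsWithin_le_nhds (s := {0}ᶜ))
      simpa [Real.zero_rpow hε.ne'] using this
    refine h1.congr' ?_
    filter_upwards [self_mem_nhdsWithin] with y hy
    have hy : y ≠ 0 := hy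
    simp [slope_def_field, hy]
  · exact key 1 (by simp) (by linarith)

theorem continuous_powerNl (hε : 0 < ε) : Continuous (powerNl A B ε) :=
  continuous_iff_continuousAt.2 fun x => (hasDerivAt_powerNl hε x).continuousAt

theorem continuous_powerPot (hε : 0 < ε) : Continuous (powerPot A B ε) :=
  continuous_iff_continuousAt.2 fun x => (hasDerivAt_powerPot hε x).continuousAt

theorem continuous_powerNlDeriv (hε : 0 < ε) : Continuous (powerNlDeriv A B ε) := by
  have hc : Continuous fun y : ℝ => |y| ^ ε := continuous_abs.rpow_const fun _ => Or.inr hε.le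
  unfold powerNlDeriv
  fun_prop

/-- The power term is superquadratic: beyond the R chosen here it dominates (B/2 + 1)x². Since the
energy decreases, this yields a priori bounds on solutions. -/
theorem powerPot_coercive (hA : 0 < A) (hB : 0 < B) (hε : 0 < ε) :
    ∃ C, ∀ x, x ^ 2 - C ≤ powerPot A B ε x := by
  set r : ℝ := (B / 2 + 1) * (2 + ε) / A with hr
  have hr0 : 0 < r := by positivity
  set R : ℝ := r ^ (1 / ε) with hR
  have hR0 : 0 < R := Real.rpow_pos_of_pos hr0 _
  have hRε : R ^ ε = r := by
    rw [hR, ← Real.rpow_mul hr0.le, one_div_mul_cancel hε.ne', Real.rpow_one]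
  refine ⟨(B / 2 + 1) * R ^ 2, fun x => ?_⟩
  rw [powerPot]
  rcases le_total R |x| with h | h
  · have h1 : r ≤ |x| ^ ε := hRε ▸ Real.rpow_le_rpow hR0.le h hε.le
    have h2 : |x| ^ (2 + ε) = x ^ 2 * |x| ^ ε := by
      rw [Real.rpow_add (hR0.trans_le h), Real.rpow_two, sq_abs]
    have h3 : A / (2 + ε) * r = B / 2 + 1 := by rw [hr]; field_simp
    have h4 : B / 2 + 1 ≤ A / (2 + ε) * |x| ^ ε := by rw [← h3]; gcongr
    have h5 : 0 < (B / 2 + 1) * R ^ 2 := by positivity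
    rw [h2]
    nlinarith [mul_le_mul_of_nonneg_left h4 (sq_nonneg x)]
  · have h1 : 0 ≤ A / (2 + ε) * |x| ^ (2 + ε) := by positivity
    have h2 : x ^ 2 ≤ R ^ 2 := by rw [← sq_abs]; gcongr
    nlinarith

theorem abs_powerNlDeriv_le (hA : 0 < A) (hB : 0 < B) (hε : 0 < ε) {M x : ℝ} (hx : |x| ≤ M) :
    |powerNlDeriv A B ε x| ≤ A * (1 + ε) * M ^ ε + B := by
  have h1 : |x| ^ ε ≤ M ^ ε := Real.rpow_le_rpow (abs_nonneg _) hx hε.le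
  have h2 : 0 ≤ |x| ^ ε := by positivity
  have h3 : 0 < A * (1 + ε) := by positivity
  rw [powerNlDeriv, abs_le]
  constructor <;> nlinarith

theorem abs_powerNl_sub_le (hA : 0 < A) (hB : 0 < B) (hε : 0 < ε) {M x y : ℝ} (hx : |x| ≤ M)
    (hy : |y| ≤ M) :
    |powerNl A B ε x - powerNl A B ε y| ≤ (A * (1 + ε) * M ^ ε + B) * |x - y| :=
  (convex_Icc (-M) M).norm_image_sub_le_of_norm_hasDerivWithin_le
    (fun z _ => (hasDerivAt_powerNl hε z).hasDerivWithinAt)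
    (fun _ hz => abs_powerNlDeriv_le hA hB hε (abs_le.2 hz)) (abs_le.1 hy) (abs_le.1 hx)

/-- Uniform continuity of f' on a compact interval suffices; no quadratic remainder is available, as
f is not C² at 0 when ε < 1. -/
theorem powerNl_taylor (hε : 0 < ε) (M : ℝ) {c : ℝ} (hc : 0 < c) :
    ∃ δ > 0, ∀ x y, |x| ≤ M → |y| ≤ M → |y - x| < δ →
      |powerNl A B ε y - powerNl A B ε x - powerNlDeriv A B ε x * (y - x)| ≤ c * |y - x| := by
  have huc : UniformContinuousOn (powerNlDeriv A B ε) (Icc (-M) M) :=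
    isCompact_Icc.uniformContinuousOn_of_continuous (continuous_powerNlDeriv hε).continuousOn
  obtain ⟨δ, hδ, H⟩ := Metric.uniformContinuousOn_iff.1 huc c hc
  refine ⟨δ, hδ, fun x y hx hy hxy => ?_⟩
  have hsub : uIcc x y ⊆ Icc (-M) M := uIcc_subset_Icc (abs_le.1 hx) (abs_le.1 hy)
  have := (convex_uIcc x y).norm_image_sub_le_of_norm_hasDerivWithin_le
    (f := fun t => powerNl A B ε t - powerNlDeriv A B ε x * t)
    (f' := fun t => powerNlDeriv A B ε t - powerNlDeriv A B ε x * 1) (C := c)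
    (fun z _ => ((hasDerivAt_powerNl hε z).sub
      ((hasDerivAt_id z).const_mul (powerNlDeriv A B ε x))).hasDerivWithinAt)
    (fun z hz => by
      have h1 := H z (hsub hz) x (abs_le.1 hx) (by
        rw [Real.dist_eq]
        exact (abs_sub_left_of_mem_uIcc hz).trans_lt hxy)
      rw [Real.dist_eq] at h1
      rw [mul_one]
      exact h1.le) left_mem_uIcc right_mem_uIcc
  rw [Real.norm_eq_abs, Real.norm_eq_abs] at this
  convert this using 2
  ring

end Nonlinearity

/-! ### The nonlinear initial value problem -/

/-- The energy `p² / 2 + F(u)`. -/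
noncomputable def radialEnergy (A B ε : ℝ) (u p : ℝ → ℝ) (τ : ℝ) : ℝ :=
  p τ ^ 2 / 2 + powerPot A B ε (u τ)

section IVP

variable {A B ε : ℝ} {u p h : ℝ → ℝ}

theorem RadialPair.continuousOn_radialEnergy (hε : 0 < ε) (H : RadialPair u p h) :
    ContinuousOn (radialEnergy A B ε u p) (Ici 0) :=
  ((H.2.pow 2).div_const 2).add ((continuous_powerPot hε).comp_continuousOn H.1)

theorem RadialPair.hasDerivAt_radialEnergy (hε : 0 < ε) (H : RadialPair u p h) {τ : ℝ}
    (hτ : 0 < τ) (hh : h τ = powerNl A B ε (u τ)) :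
    HasDerivAt (radialEnergy A B ε u p) (-(Real.cosh τ / Real.sinh τ) * p τ ^ 2) τ := by
  refine HasDerivAt.congr_deriv ((((H.5 τ hτ).pow 2).div_const 2).add
    ((hasDerivAt_powerPot hε (u τ)).comp τ (H.4 τ hτ))) ?_
  rw [hh]
  push_cast
  ring

theorem RadialPair.radialEnergy_le (hε : 0 < ε) (H : RadialPair u p h) {a b : ℝ} (ha : 0 ≤ a)
    (hab : a ≤ b) (hh : ∀ τ ∈ Ioo a b, h τ = powerNl A B ε (u τ)) :
    radialEnergy A B ε u p b ≤ radialEnergy A B ε u p a := by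
  have := le_of_hasDerivAt_nonneg (g := fun t => -radialEnergy A B ε u p t) hab
    ((H.continuousOn_radialEnergy hε).neg.mono fun x hx => ha.trans hx.1)
    (fun x hx => (H.hasDerivAt_radialEnergy hε (ha.trans_lt hx.1) (hh x hx)).neg)
    (fun x hx => by
      have h1 := Real.sinh_pos_iff.2 (ha.trans_lt hx.1)
      have h2 := Real.cosh_pos x
      have : 0 ≤ (Real.cosh x / Real.sinh x) * p x ^ 2 := by positivity
      linarith)
  linarith

theorem RadialPair.radialEnergy_zero (H : RadialPair u p h) :
    radialEnergy A B ε u p 0 = powerPot A B ε (u 0) := by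
  simp [radialEnergy, H.3]

theorem RadialPair.abs_le_of_powerPot_le (hε : 0 < ε)
    (H : RadialPair u p fun τ => powerNl A B ε (u τ)) {C M : ℝ} (hM : 0 ≤ M)
    (hC : ∀ x, x ^ 2 - C ≤ powerPot A B ε x) (h0 : powerPot A B ε (u 0) + C ≤ M ^ 2) {τ : ℝ}
    (hτ : 0 ≤ τ) : |u τ| ≤ M := by
  have h1 := H.radialEnergy_le (A := A) (B := B) hε le_rfl hτ fun _ _ => rfl
  rw [H.radialEnergy_zero, radialEnergy] at h1
  have h2 := hC (u τ)
  refine abs_le_of_sq_le_sq ?_ hM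
  nlinarith [sq_nonneg (p τ)]

/-- Clamping the argument of f to [-M, M] makes it Lipschitz. Up to the first time with |u| = M the
clamp is inactive, so the true energy is at most F(α); coercivity then contradicts M² = F(α) + C +
1, where the 1 provides strictness. -/
theorem exists_radialPair_powerNl (hA : 0 < A) (hB : 0 < B) (hε : 0 < ε) (α : ℝ) :
    ∃ u p, RadialPair u p (fun τ => powerNl A B ε (u τ)) ∧ u 0 = α := by
  obtain ⟨C, hC⟩ := powerPot_coercive hA hB hε
  set M : ℝ := √(powerPot A B ε α + C + 1) with hM
  have hα := hC α
  have hM2 : M ^ 2 = powerPot A B ε α + C + 1 := Real.sq_sqrt (by nlinarith [sq_nonneg α])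
  have hM0 : 0 ≤ M := Real.sqrt_nonneg _
  let φ : ℝ → ℝ := fun x => max (-M) (min M x)
  have hφ : ∀ x, |φ x| ≤ M := fun x => by
    rw [abs_le]
    exact ⟨le_max_left _ _, max_le (by linarith) (min_le_left _ _)⟩
  have hφe : ∀ x, |x| ≤ M → φ x = x := fun x hx => by
    have := abs_le.1 hx
    simp only [φ]
    rw [min_eq_right this.2, max_eq_right this.1]
  have hφl : ∀ x y, |φ x - φ y| ≤ |x - y| := fun x y =>
    (abs_max_sub_max_le_max _ _ _ _).trans (by
      simp only [sub_self, abs_zero]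
      refine max_le (abs_nonneg _) ((abs_min_sub_min_le_max _ _ _ _).trans ?_)
      simp)
  obtain ⟨u, p, H, hu0⟩ := exists_radialPair (fun _ y => powerNl A B ε (φ y))
    (K := A * (1 + ε) * M ^ ε + B) (C := |powerNl A B ε (φ 0)|)
    (by have := continuous_powerNl (A := A) (B := B) hε
        simp only [φ]
        fun_prop)
    (by positivity)
    (fun _ y z => (abs_powerNl_sub_le hA hB hε (hφ y) (hφ z)).trans
      (mul_le_mul_of_nonneg_left (hφl y z) (by positivity)))
    (fun _ => le_rfl) α
  refine ⟨u, p, H.congr_right fun τ hτ => ?_, hu0⟩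
  rw [hφe]
  by_contra hcon
  have hg : M ^ 2 - u τ ^ 2 ≤ 0 := by
    have := sq_le_sq' (by linarith) (not_le.1 hcon).le
    rw [sq_abs] at this
    linarith
  obtain ⟨e, he, hge, hlt⟩ := exists_first_zero (g := fun t => M ^ 2 - u t ^ 2) hτ.le
    ((continuousOn_const.sub (H.1.pow 2)).mono Icc_subset_Ici_self)
    (by simp only [hu0]; linarith) hg
  have h1 := H.radialEnergy_le (A := A) (B := B) hε le_rfl he.1.le fun t ht => by
    rw [hφe]
    exact abs_le_of_sq_le_sq (by have := hlt t ⟨ht.1.le, ht.2⟩; linarith) hM0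
  rw [H.radialEnergy_zero, radialEnergy, hu0] at h1
  have h2 := hC (u e)
  nlinarith [sq_nonneg (p e)]

theorem RadialPair.eq_of_powerNl (hA : 0 < A) (hB : 0 < B) (hε : 0 < ε) {v r : ℝ → ℝ}
    (H : RadialPair u p fun τ => powerNl A B ε (u τ))
    (H' : RadialPair v r fun τ => powerNl A B ε (v τ)) (h0 : u 0 = v 0) {τ : ℝ} (hτ : 0 ≤ τ) :
    u τ = v τ := by
  obtain ⟨C, hC⟩ := powerPot_coercive hA hB hε
  have hα := hC (v 0)
  have hM2 : powerPot A B ε (v 0) + C ≤ √(powerPot A B ε (v 0) + C) ^ 2 :=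
    (Real.sq_sqrt (by nlinarith [sq_nonneg (v 0)])).ge
  have hM0 := Real.sqrt_nonneg (powerPot A B ε (v 0) + C)
  set M : ℝ := √(powerPot A B ε (v 0) + C)
  have := (H.sub H').energy_le (K := A * (1 + ε) * M ^ ε + B) (η := 0) (T := τ) (by positivity)
    (fun t ht => by
      rw [add_zero]
      exact abs_powerNl_sub_le hA hB hε
        (H.abs_le_of_powerPot_le hε hM0 hC (by rwa [h0]) ht.1.le)
        (H'.abs_le_of_powerPot_le hε hM0 hC hM2 ht.1.le)) (right_mem_Icc.2 hτ)
  simp only [h0, sub_self] at this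
  nlinarith [sq_nonneg (u τ - v τ), sq_nonneg (p τ - r τ)]

/-- The solutions of the initial value problem are differentiable with respect to the initial
value, locally uniformly in `τ` and together with their derivatives. -/
theorem exists_variation (hA : 0 < A) (hB : 0 < B) (hε : 0 < ε) {U P : ℝ → ℝ → ℝ}
    (hU : ∀ a, 0 < a → RadialPair (U a) (P a) fun τ => powerNl A B ε (U a τ))
    (hU0 : ∀ a, 0 < a → U a 0 = a) {α : ℝ} (hα : 0 < α) :
    ∃ w r, RadialPair w r (fun τ => powerNlDeriv A B ε (U α τ) * w τ) ∧ w 0 = 1 ∧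
      ∀ T, 0 ≤ T → ∀ c, 0 < c → ∀ᶠ a in 𝓝 α, ∀ τ ∈ Icc 0 T,
        |U a τ - U α τ - (a - α) * w τ| ≤ c * |a - α| ∧
        |P a τ - P α τ - (a - α) * r τ| ≤ c * |a - α| := by
  obtain ⟨C, hC⟩ := powerPot_coercive hA hB hε
  have hαC := hC α
  have hM2 : √(powerPot A B ε α + 1 + C) ^ 2 = powerPot A B ε α + 1 + C :=
    Real.sq_sqrt (by nlinarith [sq_nonneg α])
  have hM0 := Real.sqrt_nonneg (powerPot A B ε α + 1 + C)
  set M : ℝ := √(powerPot A B ε α + 1 + C)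
  have hbd : ∀ a, 0 < a → powerPot A B ε a < powerPot A B ε α + 1 → ∀ τ, 0 ≤ τ → |U a τ| ≤ M :=
    fun a ha hpa τ hτ => (hU a ha).abs_le_of_powerPot_le hε hM0 hC
      (by rw [hU0 a ha, hM2]; linarith) hτ
  have hbα := hbd α hα (by linarith)
  set K : ℝ := A * (1 + ε) * M ^ ε + B
  have hK : 0 ≤ K := by positivity
  have hUc : Continuous fun x : ℝ => U α (max x 0) :=
    (hU α hα).1.comp_continuous (by fun_prop) fun x => mem_Ici.2 (le_max_right x 0)
  obtain ⟨w, r, W, hw0⟩ := exists_radialPair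
    (fun x y => powerNlDeriv A B ε (U α (max x 0)) * y) (K := K) (C := 0)
    ((((continuous_powerNlDeriv hε).comp hUc).comp continuous_fst).mul continuous_snd) hK
    (fun x y z => by
      rw [← mul_sub, abs_mul]
      exact mul_le_mul_of_nonneg_right
        (abs_powerNlDeriv_le hA hB hε (hbα _ (le_max_right _ _))) (abs_nonneg _))
    (by simp) 1
  replace W := W.congr_right (h₂ := fun τ => powerNlDeriv A B ε (U α τ) * w τ)
    fun τ hτ => by simp only [max_eq_left hτ.le]
  refine ⟨w, r, W, hw0, fun T hT c hc => ?_⟩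
  set X : ℝ := Real.exp ((K + 2) * T) with hX
  have hX1 : 1 ≤ X := Real.one_le_exp (by positivity)
  -- Chosen so that the energy estimate with η = c'X|a - α| gives c²|a - α|² T/(X(T + 1)²) ≤ c²|a -
  -- α|².
  set c' : ℝ := c / (X ^ 2 * (T + 1)) with hc'
  have hc'0 : 0 < c' := by positivity
  obtain ⟨δ, hδ, hTay⟩ := powerNl_taylor (A := A) (B := B) hε M hc'0
  have hpot : ∀ᶠ a in 𝓝 α, powerPot A B ε a < powerPot A B ε α + 1 :=
    (continuous_powerPot hε).continuousAt.eventually (gt_mem_nhds (by linarith))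
  have hcl : ∀ᶠ a in 𝓝 α, X * |a - α| < δ := by
    have : Continuous fun a : ℝ => X * |a - α| := by fun_prop
    exact this.continuousAt.eventually (gt_mem_nhds (by simpa using hδ))
  filter_upwards [hpot, hcl, lt_mem_nhds hα] with a ha1 ha2 ha0 τ hτ
  have hba := hbd a ha0 ha1
  have hlip : ∀ t ∈ Icc 0 T, |U a t - U α t| ≤ X * |a - α| := by
    intro t ht
    have h1 := ((hU a ha0).sub (hU α hα)).energy_le (η := 0) hK
      (fun t ht => by
        rw [add_zero]
        exact abs_powerNl_sub_le hA hB hε (hba t ht.1.le) (hbα t ht.1.le)) ht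
    rw [hU0 a ha0, hU0 α hα] at h1
    refine abs_le_of_sq_le_sq ?_ (by positivity)
    rw [mul_pow, sq_abs]
    have h2 : X * (a - α) ^ 2 ≤ X ^ 2 * (a - α) ^ 2 := by
      gcongr
      nlinarith
    nlinarith [sq_nonneg (P a t - P α t)]
  have h1 := (((hU a ha0).sub (hU α hα)).sub (W.const_mul (a - α))).energy_le
    (K := K) (η := c' * (X * |a - α|)) (T := T) hK
    (fun t ht => by
      have h2 := hTay (U α t) (U a t) (hbα t ht.1.le) (hba t ht.1.le)
        ((hlip t ⟨ht.1.le, ht.2.le⟩).trans_lt ha2)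
      have h3 := hlip t ⟨ht.1.le, ht.2.le⟩
      have h4 := abs_powerNlDeriv_le hA hB hε (hbα t ht.1.le)
      have h5 : powerNl A B ε (U a t) - powerNl A B ε (U α t) -
          (a - α) * (powerNlDeriv A B ε (U α t) * w t) =
          powerNlDeriv A B ε (U α t) * (U a t - U α t - (a - α) * w t) +
          (powerNl A B ε (U a t) - powerNl A B ε (U α t) -
            powerNlDeriv A B ε (U α t) * (U a t - U α t)) := by ring
      rw [h5]
      refine (abs_add_le _ _).trans (add_le_add ?_ (h2.trans (by gcongr)))
      rw [abs_mul]
      gcongr) hτ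
  have h6 : X * (((U a 0 - U α 0 - (a - α) * w 0) ^ 2) + (c' * (X * |a - α|)) ^ 2 * T) ≤
      (c * |a - α|) ^ 2 := by
    rw [hU0 a ha0, hU0 α hα, hw0]
    have e1 : X * ((a - α - (a - α) * 1) ^ 2 + (c' * (X * |a - α|)) ^ 2 * T) =
        (c * |a - α|) ^ 2 * (T / (X * (T + 1) ^ 2)) := by
      rw [hc']; field_simp; ring
    rw [e1]
    refine mul_le_of_le_one_right (sq_nonneg _) ?_
    rw [div_le_one (by positivity)]
    nlinarith [sq_nonneg T]
  have h7 := h1.trans h6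
  exact ⟨abs_le_of_sq_le_sq ((le_add_of_nonneg_right (sq_nonneg _)).trans h7) (by positivity),
    abs_le_of_sq_le_sq ((le_add_of_nonneg_left (sq_nonneg _)).trans h7) (by positivity)⟩

end IVP

/-! ### A generalized Pohozaev identity and the linearized equation -/

/-- The generalized Pohozaev function of a solution `u` with derivative `p`. -/
noncomputable def pohozaev (A B ε : ℝ) (u p : ℝ → ℝ) (τ : ℝ) : ℝ :=
  Real.sinh τ ^ (ε / (4 + ε)) * (Real.sinh τ * p τ ^ 2 / 2 +
    2 / (4 + ε) * (Real.cosh τ * (u τ * p τ)) +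
    1 / (4 + ε) * (4 / (4 + ε) / Real.sinh τ - ε / (4 + ε) * Real.sinh τ) * u τ ^ 2 +
    Real.sinh τ * powerPot A B ε (u τ))

/-- The Wronskian of a solution `u` and its variation `w`, with derivatives `p` and `r`. -/
def wronskian (u p w r : ℝ → ℝ) (τ : ℝ) : ℝ := p τ * w τ - u τ * r τ

/-- The linearization of the Pohozaev function along `w`, corrected by `2 (w / u) J`. -/
noncomputable def pohozaevVariation (A ε : ℝ) (u p w r : ℝ → ℝ) (τ : ℝ) : ℝ :=
  Real.sinh τ ^ (ε / (4 + ε)) * (wronskian u p w r τ *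
      (Real.sinh τ * (p τ / u τ) + 2 / (4 + ε) * Real.cosh τ) -
    A * ε / (2 + ε) * (Real.sinh τ * (w τ * (|u τ| ^ ε * u τ))))

section Identities

variable {A B ε : ℝ} {u p w r : ℝ → ℝ} {τ : ℝ}

theorem powerPot_of_pos (hx : 0 < τ) :
    powerPot A B ε τ = A / (2 + ε) * (|τ| ^ ε * τ ^ 2) - B / 2 * τ ^ 2 := by
  rw [powerPot, abs_of_pos hx, Real.rpow_add hx, Real.rpow_two]
  ring

theorem hasDerivAt_sinh_rpow (κ : ℝ) (hτ : 0 < τ) :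
    HasDerivAt (fun t => Real.sinh t ^ κ)
      (κ * (Real.cosh τ / Real.sinh τ) * Real.sinh τ ^ κ) τ := by
  have hs := Real.sinh_pos_iff.2 hτ
  refine HasDerivAt.congr_deriv ((Real.hasDerivAt_sinh τ).rpow_const (Or.inl hs.ne')) ?_
  rw [Real.rpow_sub_one hs.ne']
  field_simp

theorem hasDerivAt_abs_rpow_comp {q : ℝ} (hu : HasDerivAt u q τ) (hpos : 0 < u τ) :
    HasDerivAt (fun t => |u t| ^ ε) (ε * |u τ| ^ ε / u τ * q) τ := by
  have h1 : (fun t => |u t| ^ ε) =ᶠ[𝓝 τ] fun t => u t ^ ε := by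
    filter_upwards [hu.continuousAt.eventually (lt_mem_nhds hpos)] with t ht
    rw [abs_of_pos ht]
  refine HasDerivAt.congr_deriv ((hu.rpow_const (Or.inl hpos.ne')).congr_of_eventuallyEq h1) ?_
  rw [Real.rpow_sub_one hpos.ne', abs_of_pos hpos]
  ring

theorem cosh_sq_sub (τ : ℝ) : Real.cosh τ ^ 2 - (1 + Real.sinh τ ^ 2) = 0 := by
  rw [Real.cosh_sq]; ring

/-- The exponent κ = ε/(4 + ε) and the coefficient 2/(4 + ε) of cosh · up are the ones for which the
p² and |u|^(2+ε) terms both cancel: (κ - 1)/2 + 2/(4 + ε) = 0 and (1 + κ)/(2 + ε) = 2/(4 + ε). The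
coefficient of u² in J removes the up term, so only a multiple of u² survives, of a definite sign
for B > 0. -/
theorem hasDerivAt_pohozaev (hε : 0 < ε) (H : RadialPair u p fun τ => powerNl A B ε (u τ))
    (hτ : 0 < τ) (hu : 0 < u τ) :
    HasDerivAt (pohozaev A B ε u p)
      (-(Real.sinh τ ^ (ε / (4 + ε)) * Real.cosh τ / Real.sinh τ ^ 2 * u τ ^ 2 *
        (B * (ε / (4 + ε)) * Real.sinh τ ^ 2 + 1 / (4 + ε) * (16 / (4 + ε) ^ 2 +
          ε / (4 + ε) * (ε / (4 + ε) + 1) * Real.sinh τ ^ 2)))) τ := by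
  have hs : Real.sinh τ ≠ 0 := (Real.sinh_pos_iff.2 hτ).ne'
  have ds := Real.hasDerivAt_sinh τ
  have dc := Real.hasDerivAt_cosh τ
  have du := H.4 τ hτ
  have dp := H.5 τ hτ
  have dF := (hasDerivAt_powerPot (A := A) (B := B) hε (u τ)).comp τ du
  have dσ := hasDerivAt_sinh_rpow (ε / (4 + ε)) hτ
  have h1 := ((ds.mul (dp.pow 2)).div_const 2).add ((dc.mul (du.mul dp)).const_mul (2 / (4 + ε)))
  have h2 := ((((ds.inv hs).const_mul (4 / (4 + ε))).sub (ds.const_mul (ε / (4 + ε)))).const_mul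
    (1 / (4 + ε))).mul (du.pow 2)
  refine HasDerivAt.congr_deriv (dσ.mul ((h1.add h2).add (ds.mul dF))) ?_
  have h3 : (2 + ε) ≠ 0 := by positivity
  have h4 : (4 + ε) ≠ 0 := by positivity
  have hu0 := hu.ne'
  simp only [Pi.mul_apply, Pi.pow_apply, Pi.inv_apply, Pi.sub_apply]
  rw [powerPot_of_pos hu, powerNl]
  generalize Real.sinh τ ^ (ε / (4 + ε)) = σ
  generalize |u τ| ^ ε = P
  have hch := cosh_sq_sub τ
  generalize Real.sinh τ = s at *
  generalize Real.cosh τ = c at *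
  generalize u τ = x at *
  generalize p τ = y at *
  -- The two sides differ by exactly this multiple of cosh² - 1 - sinh², coming from the up terms.
  have key := congrArg (fun z => σ * (-8 / (4 + ε) ^ 2 / s) * x * y * z) hch
  simp only [mul_zero] at key
  rw [← sub_eq_zero, ← key, ← sub_eq_zero]
  push_cast
  field_simp
  ring

theorem hasDerivAt_wronskian (H : RadialPair u p fun τ => powerNl A B ε (u τ))
    (W : RadialPair w r fun τ => powerNlDeriv A B ε (u τ) * w τ) (hτ : 0 < τ) :
    HasDerivAt (wronskian u p w r)
      (-(Real.cosh τ / Real.sinh τ) * wronskian u p w r τ +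
        A * ε * (|u τ| ^ ε * u τ) * w τ) τ := by
  refine HasDerivAt.congr_deriv
    (((H.5 τ hτ).mul (W.4 τ hτ)).sub ((H.4 τ hτ).mul (W.5 τ hτ))) ?_
  rw [powerNl, powerNlDeriv, wronskian]
  ring

/-- With Y = 2(w/u)J - DJ[w]: as J' is a function of τ times u², linearizing along w gives (DJ[w])'
= 2(w/u)J'. This cancels against the same term in the product rule and leaves 2(w/u)'J. -/
theorem hasDerivAt_pohozaevVariation (hε : 0 < ε)
    (H : RadialPair u p fun τ => powerNl A B ε (u τ))
    (W : RadialPair w r fun τ => powerNlDeriv A B ε (u τ) * w τ) (hτ : 0 < τ) (hu : 0 < u τ) :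
    HasDerivAt (pohozaevVariation A ε u p w r)
      (-(2 * wronskian u p w r τ / u τ ^ 2 * pohozaev A B ε u p τ)) τ := by
  have hs : Real.sinh τ ≠ 0 := (Real.sinh_pos_iff.2 hτ).ne'
  have ds := Real.hasDerivAt_sinh τ
  have dc := Real.hasDerivAt_cosh τ
  have du := H.4 τ hτ
  have dp := H.5 τ hτ
  have dw := W.4 τ hτ
  have dW := hasDerivAt_wronskian H W hτ
  have dP := hasDerivAt_abs_rpow_comp (ε := ε) du hu
  have dσ := hasDerivAt_sinh_rpow (ε / (4 + ε)) hτ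
  have hu0 := hu.ne'
  refine HasDerivAt.congr_deriv (dσ.mul ((dW.mul ((ds.mul (dp.div du hu0)).add
    (dc.const_mul (2 / (4 + ε))))).sub
      ((ds.mul (dw.mul (dP.mul du))).const_mul (A * ε / (2 + ε))))) ?_
  have h3 : (2 + ε) ≠ 0 := by positivity
  have h4 : (4 + ε) ≠ 0 := by positivity
  simp only [Pi.add_apply, Pi.mul_apply, Pi.div_apply]
  rw [pohozaev, powerPot_of_pos hu, powerNl]
  simp only [wronskian]
  generalize Real.sinh τ ^ (ε / (4 + ε)) = σ
  generalize |u τ| ^ ε = P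
  have hch := cosh_sq_sub τ
  generalize Real.sinh τ = s at *
  generalize Real.cosh τ = c at *
  generalize u τ = x at *
  generalize p τ = y at *
  generalize w τ = z at *
  generalize r τ = v at *
  have key := congrArg (fun t => σ * (-8 / (4 + ε) ^ 2 / s) * (y * z - x * v) * t) hch
  simp only [mul_zero] at key
  rw [← sub_eq_zero, ← key, ← sub_eq_zero]
  field_simp
  ring

end Identities

/-! ### Signs of the derivative, the Wronskian and the Pohozaev function. -/

section Signs

variable {A B ε : ℝ} {u p w r : ℝ → ℝ} {b : ℝ}

/-- A nonnegative potential means A|x|^ε ≥ B(2 + ε)/2, which exceeds B. -/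
theorem powerNl_pos_of_powerPot_nonneg (hB : 0 < B) (hε : 0 < ε) {x : ℝ}
    (hx : 0 < x) (h : 0 ≤ powerPot A B ε x) : 0 < powerNl A B ε x := by
  rw [powerPot_of_pos hx] at h
  rw [powerNl]
  have h1 : 0 ≤ (A / (2 + ε) * |x| ^ ε - B / 2) * x ^ 2 := by linarith
  have h2 : 0 ≤ A / (2 + ε) * |x| ^ ε - B / 2 := nonneg_of_mul_nonneg_left h1 (by positivity)
  have h3 : A / (2 + ε) * |x| ^ ε * (2 + ε) = A * |x| ^ ε := by field_simp
  have h4 : 0 < A * |x| ^ ε - B := by nlinarith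
  nlinarith

/-- A positive solution of nonnegative energy is strictly decreasing. -/
theorem RadialPair.snd_neg (hB : 0 < B) (hε : 0 < ε)
    (H : RadialPair u p fun τ => powerNl A B ε (u τ)) (hu : ∀ τ ∈ Ico 0 b, 0 < u τ)
    (hE : ∀ τ ∈ Ico 0 b, 0 ≤ radialEnergy A B ε u p τ) {τ : ℝ} (hτ : τ ∈ Ioo 0 b) : p τ < 0 := by
  have hb : 0 < b := hτ.1.trans hτ.2
  have hfc : ContinuousOn (fun t => powerNl A B ε (u t)) (Ici 0) :=
    (continuous_powerNl hε).comp_continuousOn H.1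
  have hf0 : 0 < powerNl A B ε (u 0) := by
    refine powerNl_pos_of_powerPot_nonneg hB hε (hu 0 ⟨le_rfl, hb⟩) ?_
    have := hE 0 ⟨le_rfl, hb⟩
    rwa [H.radialEnergy_zero] at this
  have hq : ContinuousOn (fun t => -(Real.sinh t * p t)) (Ici 0) := H.continuousOn_sinh_mul.neg
  have hqd : ∀ t, 0 < t → HasDerivAt (fun t => -(Real.sinh t * p t))
      (Real.sinh t * powerNl A B ε (u t)) t := fun t ht =>
    HasDerivAt.congr_deriv (H.hasDerivAt_sinh_mul ht).neg (by ring)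
  have hev : ∀ᶠ t in 𝓝[≥] (0 : ℝ), 0 < powerNl A B ε (u t) :=
    (hfc 0 self_mem_Ici).eventually (lt_mem_nhds hf0)
  obtain ⟨δ, hδ, hδf⟩ := (mem_nhdsGE_iff_exists_Icc_subset (a := (0 : ℝ))).1 hev
  have hδ0 : 0 < δ := hδ
  have hpos : ∀ t ∈ Ioc 0 δ, 0 < -(Real.sinh t * p t) := by
    intro t ht
    have := lt_of_hasDerivAt_pos ht.1 (hq.mono Icc_subset_Ici_self) (fun x hx => hqd x hx.1)
      (fun x hx => mul_pos (Real.sinh_pos_iff.2 hx.1) (hδf ⟨hx.1.le, hx.2.le.trans ht.2⟩))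
    simpa [H.3] using this
  have hs := Real.sinh_pos_iff.2 hτ.1
  suffices h : 0 < -(Real.sinh τ * p τ) by nlinarith
  rcases le_total τ δ with h | h
  · exact hpos τ ⟨hτ.1, h⟩
  by_contra hcon
  obtain ⟨e, he, hqe, hlt⟩ := exists_first_zero h
    (hq.mono fun x hx => hδ0.le.trans hx.1) (hpos δ ⟨hδ0, le_rfl⟩) (not_lt.1 hcon)
  have he0 : 0 < e := hδ0.trans he.1
  have heb : e ∈ Ico 0 b := ⟨he0.le, he.2.trans_lt hτ.2⟩
  have hse := Real.sinh_pos_iff.2 he0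
  have hpe : p e = 0 := by
    have : Real.sinh e * p e = 0 := by linarith
    rcases mul_eq_zero.1 this with h | h
    · exact absurd h hse.ne'
    · exact h
  -- Where p vanishes the energy is purely potential, so f(u) > 0 there. Then -sinh · p is
  -- increasing just before e, and cannot descend to 0 from positive values.
  have hfe : 0 < powerNl A B ε (u e) := by
    refine powerNl_pos_of_powerPot_nonneg hB hε (hu e heb) ?_
    have := hE e heb
    simpa [radialEnergy, hpe] using this
  have hev : ∀ᶠ t in 𝓝 e, 0 < powerNl A B ε (u t) :=
    ((hfc.continuousAt (Ici_mem_nhds he0))).eventually (lt_mem_nhds hfe)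
  obtain ⟨l, hl, hlf⟩ := exists_Ioc_subset_of_mem_nhds hev ⟨δ, he.1⟩
  set m := max l δ
  have hme : m < e := max_lt hl he.1
  have hm0 : δ ≤ m := le_max_right _ _
  have := lt_of_hasDerivAt_pos hme (hq.mono fun x hx => (hδ0.le.trans hm0).trans hx.1)
    (fun x hx => hqd x (hδ0.trans_le (hm0.trans hx.1.le)))
    (fun x hx => mul_pos (Real.sinh_pos_iff.2 (hδ0.trans_le (hm0.trans hx.1.le)))
      (hlf ⟨(le_max_left _ _).trans_lt hx.1, hx.2.le⟩))
  have h2 := hlt m ⟨hm0, hme⟩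
  rw [hqe] at this
  linarith

theorem continuous_sinh_rpow (hε : 0 < ε) : Continuous fun t => Real.sinh t ^ (ε / (4 + ε)) :=
  Real.continuous_sinh.rpow_const fun _ => Or.inr (by positivity)

theorem RadialPair.continuousOn_wronskian {h h₂ : ℝ → ℝ} (H : RadialPair u p h)
    (W : RadialPair w r h₂) : ContinuousOn (wronskian u p w r) (Ici 0) :=
  (H.2.mul W.1).sub (H.1.mul W.2)

theorem RadialPair.continuousOn_pohozaevVariation (hε : 0 < ε) {h h₂ : ℝ → ℝ}
    (H : RadialPair u p h) (W : RadialPair w r h₂) {s : Set ℝ} (hs : s ⊆ Ici 0)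
    (hu : ∀ τ ∈ s, 0 < u τ) : ContinuousOn (pohozaevVariation A ε u p w r) s := by
  have h1 := continuous_sinh_rpow hε
  have h2 := (H.continuousOn_wronskian W).mono hs
  have h3 := (H.2.mono hs).div (H.1.mono hs) fun x hx => (hu x hx).ne'
  have h4 : ContinuousOn (fun t => |u t| ^ ε) s :=
    (continuous_abs.comp_continuousOn (H.1.mono hs)).rpow_const fun _ _ => Or.inr hε.le
  have h5 := H.1.mono hs
  have h6 := W.1.mono hs
  unfold pohozaevVariation
  refine h1.continuousOn.mul ((h2.mul ((Real.continuous_sinh.continuousOn.mul h3).add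
    (by fun_prop))).sub (continuousOn_const.mul (Real.continuous_sinh.continuousOn.mul
      (h6.mul (h4.mul h5)))))

theorem RadialPair.continuousOn_pohozaev (hε : 0 < ε) {h : ℝ → ℝ} (H : RadialPair u p h) :
    ContinuousOn (pohozaev A B ε u p) (Ioi 0) := by
  have h1 := continuous_sinh_rpow hε
  have h2 : ContinuousOn u (Ioi 0) := H.1.mono Ioi_subset_Ici_self
  have h3 : ContinuousOn p (Ioi 0) := H.2.mono Ioi_subset_Ici_self
  have h4 : ContinuousOn (fun t => 4 / (4 + ε) / Real.sinh t) (Ioi 0) :=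
    continuousOn_const.div Real.continuous_sinh.continuousOn fun x hx =>
      (Real.sinh_pos_iff.2 hx).ne'
  have h5 : ContinuousOn (fun t => powerPot A B ε (u t)) (Ioi 0) :=
    (continuous_powerPot hε).comp_continuousOn h2
  have h6 := Real.continuous_sinh
  have h7 := Real.continuous_cosh
  have h8 : ContinuousOn (fun t => Real.sinh t * p t ^ 2 / 2 +
      2 / (4 + ε) * (Real.cosh t * (u t * p t))) (Ioi 0) := by fun_prop
  exact h1.continuousOn.mul ((h8.add ((continuousOn_const.mul (h4.sub
    (continuousOn_const.mul h6.continuousOn))).mul (h2.pow 2))).add (h6.continuousOn.mul h5))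

theorem pohozaevVariation_zero (hε : 0 < ε) : pohozaevVariation A ε u p w r 0 = 0 := by
  have : ε / (4 + ε) ≠ 0 := by positivity
  simp [pohozaevVariation, Real.zero_rpow this]

theorem RadialPair.hasDerivAt_sinh_mul_wronskian (H : RadialPair u p fun τ => powerNl A B ε (u τ))
    (W : RadialPair w r fun τ => powerNlDeriv A B ε (u τ) * w τ) {τ : ℝ} (hτ : 0 < τ) :
    HasDerivAt (fun t => Real.sinh t * wronskian u p w r t)
      (Real.sinh τ * (A * ε * (|u τ| ^ ε * u τ) * w τ)) τ := by
  have hs : Real.sinh τ ≠ 0 := (Real.sinh_pos_iff.2 hτ).ne'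
  refine HasDerivAt.congr_deriv ((Real.hasDerivAt_sinh τ).mul (hasDerivAt_wronskian H W hτ)) ?_
  field_simp
  ring

theorem RadialPair.pohozaevVariation_lt (hε : 0 < ε)
    (H : RadialPair u p fun τ => powerNl A B ε (u τ))
    (W : RadialPair w r fun τ => powerNlDeriv A B ε (u τ) * w τ) {x y : ℝ} (hx : 0 ≤ x)
    (hxy : x < y) (hu : ∀ τ ∈ Icc x y, 0 < u τ) (hJ : ∀ τ ∈ Ioo x y, 0 < pohozaev A B ε u p τ)
    (hΔ : ∀ τ ∈ Ioo x y, 0 < wronskian u p w r τ) :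
    pohozaevVariation A ε u p w r y < pohozaevVariation A ε u p w r x := by
  have := lt_of_hasDerivAt_pos (g := fun t => -pohozaevVariation A ε u p w r t) hxy
    (H.continuousOn_pohozaevVariation hε W (fun t ht => hx.trans ht.1) hu).neg
    (fun t ht => (hasDerivAt_pohozaevVariation hε H W (hx.trans_lt ht.1)
      (hu t (Ioo_subset_Icc_self ht))).neg)
    (fun t ht => by
      have h1 := hu t (Ioo_subset_Icc_self ht)
      have h2 := hJ t ht
      have h3 := hΔ t ht
      rw [neg_neg]
      positivity)
  linarith

/-- As long as `u` and its Pohozaev function are positive, so is the Wronskian of `u` and `w`. -/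
theorem RadialPair.wronskian_pos (hA : 0 < A) (hε : 0 < ε)
    (H : RadialPair u p fun τ => powerNl A B ε (u τ))
    (W : RadialPair w r fun τ => powerNlDeriv A B ε (u τ) * w τ) (hw0 : w 0 = 1)
    (hu : ∀ τ ∈ Ico 0 b, 0 < u τ) (hJ : ∀ τ ∈ Ioo 0 b, 0 < pohozaev A B ε u p τ)
    {τ : ℝ} (hτ : τ ∈ Ioo 0 b) : 0 < wronskian u p w r τ := by
  have hDc : ContinuousOn (fun t => Real.sinh t * wronskian u p w r t) (Ici 0) :=
    Real.continuous_sinh.continuousOn.mul (H.continuousOn_wronskian W)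
  have hDd := fun {t : ℝ} (ht : 0 < t) => H.hasDerivAt_sinh_mul_wronskian W ht
  have hcoef : ∀ t ∈ Ioo 0 b, 0 < A * ε * (|u t| ^ ε * u t) := fun t ht => by
    have := hu t ⟨ht.1.le, ht.2⟩
    positivity
  have hev : ∀ᶠ t in 𝓝[≥] (0 : ℝ), 0 < w t :=
    (W.1 0 self_mem_Ici).eventually (lt_mem_nhds (by rw [hw0]; exact one_pos))
  obtain ⟨δ, hδ, hδw⟩ := (mem_nhdsGE_iff_exists_Icc_subset (a := (0 : ℝ))).1 hev
  have hδ0 : 0 < δ := hδ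
  have hpos : ∀ t ∈ Ioo 0 b, t ≤ δ → 0 < Real.sinh t * wronskian u p w r t := by
    intro t ht htδ
    have := lt_of_hasDerivAt_pos ht.1 (hDc.mono Icc_subset_Ici_self) (fun x hx => hDd hx.1)
      (fun x hx => mul_pos (Real.sinh_pos_iff.2 hx.1) (mul_pos (hcoef x ⟨hx.1, hx.2.trans ht.2⟩)
        (hδw ⟨hx.1.le, hx.2.le.trans htδ⟩)))
    simpa using this
  suffices h : 0 < Real.sinh τ * wronskian u p w r τ from
    pos_of_mul_pos_right h (Real.sinh_pos_iff.2 hτ.1).le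
  rcases le_total τ δ with h | h
  · exact hpos τ hτ h
  by_contra hcon
  obtain ⟨e, he, hDe, hlt⟩ := exists_first_zero h (hDc.mono fun x hx => hδ0.le.trans hx.1)
    (hpos δ ⟨hδ0, h.trans_lt hτ.2⟩ le_rfl) (not_lt.1 hcon)
  have he0 : 0 < e := hδ0.trans he.1
  have heb : e < b := he.2.trans_lt hτ.2
  have hse := Real.sinh_pos_iff.2 he0
  have hΔe : wronskian u p w r e = 0 := (mul_eq_zero.1 hDe).resolve_left hse.ne'
  have hΔpos : ∀ t ∈ Ioo 0 e, 0 < wronskian u p w r t := by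
    intro t ht
    refine pos_of_mul_pos_right ?_ (Real.sinh_pos_iff.2 ht.1).le
    rcases le_total t δ with h' | h'
    · exact hpos t ⟨ht.1, ht.2.trans heb⟩ h'
    · exact hlt t ⟨h', ht.2⟩
  have hY := H.pohozaevVariation_lt hε W le_rfl he0 (fun t ht => hu t ⟨ht.1, ht.2.trans_lt heb⟩)
    (fun t ht => hJ t ⟨ht.1, ht.2.trans heb⟩) hΔpos
  rw [pohozaevVariation_zero hε] at hY
  have hue := hu e ⟨he0.le, heb⟩
  -- With Δ(e) = 0 the only surviving term of Y(e) is a negative multiple of w(e), and Y(e) < Y(0) =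
  -- 0.
  have hwe : 0 < w e := by
    rw [pohozaevVariation, hΔe, zero_mul, zero_sub] at hY
    have hσ : 0 < Real.sinh e ^ (ε / (4 + ε)) := Real.rpow_pos_of_pos hse _
    have h1 : 0 < Real.sinh e ^ (ε / (4 + ε)) * (A * ε / (2 + ε) * Real.sinh e *
      (|u e| ^ ε * u e)) := by positivity
    have h2 : 0 < Real.sinh e ^ (ε / (4 + ε)) * (A * ε / (2 + ε) * Real.sinh e *
      (|u e| ^ ε * u e)) * w e := by linarith
    exact pos_of_mul_pos_right h2 h1.le
  have hev : ∀ᶠ t in 𝓝 e, 0 < w t :=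
    ((W.1.continuousAt (Ici_mem_nhds he0))).eventually (lt_mem_nhds hwe)
  obtain ⟨l, hl, hlw⟩ := exists_Ioc_subset_of_mem_nhds hev ⟨δ, he.1⟩
  set m := max l δ
  have hme : m < e := max_lt hl he.1
  have hm0 : δ ≤ m := le_max_right _ _
  have := lt_of_hasDerivAt_pos hme (hDc.mono fun x hx => (hδ0.le.trans hm0).trans hx.1)
    (fun x hx => hDd (hδ0.trans_le (hm0.trans hx.1.le)))
    (fun x hx => by
      have hx0 : 0 < x := hδ0.trans_le (hm0.trans hx.1.le)
      exact mul_pos (Real.sinh_pos_iff.2 hx0) (mul_pos (hcoef x ⟨hx0, hx.2.trans heb⟩)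
        (hlw ⟨(le_max_left _ _).trans_lt hx.1, hx.2.le⟩)))
  have h2 := hlt m ⟨hm0, hme⟩
  simp only [hDe] at this
  linarith

/-- (w/u)' = -Δ/u²; this is what limits w to one zero and fixes its sign afterwards. -/
theorem RadialPair.div_strictAntiOn {h h₂ : ℝ → ℝ} (H : RadialPair u p h) (W : RadialPair w r h₂)
    (hu : ∀ τ ∈ Ico 0 b, 0 < u τ) (hΔ : ∀ τ ∈ Ioo 0 b, 0 < wronskian u p w r τ) :
    StrictAntiOn (fun t => w t / u t) (Ico 0 b) := by
  intro x hx y hy hxy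
  have := lt_of_hasDerivAt_pos (g := fun t => -(w t / u t))
    (g' := fun t => wronskian u p w r t / u t ^ 2) hxy
    (((W.1.mono fun t ht => hx.1.trans ht.1).div (H.1.mono fun t ht => hx.1.trans ht.1)
      fun t ht => (hu t ⟨hx.1.trans ht.1, ht.2.trans_lt hy.2⟩).ne').neg)
    (fun t ht => by
      have ht0 := hx.1.trans_lt ht.1
      refine HasDerivAt.congr_deriv ((W.4 t ht0).div (H.4 t ht0)
        (hu t ⟨ht0.le, ht.2.trans hy.2⟩).ne').neg ?_
      rw [wronskian]
      ring)
    (fun t ht => by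
      have ht0 := hx.1.trans_lt ht.1
      have h1 := hu t ⟨ht0.le, ht.2.trans hy.2⟩
      have h2 := hΔ t ⟨ht0, ht.2.trans hy.2⟩
      positivity)
  simp only at this ⊢
  linarith

theorem RadialPair.eq_of_variation_eq_zero {h h₂ : ℝ → ℝ} (H : RadialPair u p h)
    (W : RadialPair w r h₂) (hu : ∀ τ ∈ Ico 0 b, 0 < u τ)
    (hΔ : ∀ τ ∈ Ioo 0 b, 0 < wronskian u p w r τ) {x y : ℝ} (hx : x ∈ Ioo 0 b) (hy : y ∈ Ioo 0 b)
    (hwx : w x = 0) (hwy : w y = 0) : x = y :=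
  (H.div_strictAntiOn W hu hΔ).injOn ⟨hx.1.le, hx.2⟩ ⟨hy.1.le, hy.2⟩ (by simp [hwx, hwy])

theorem RadialPair.pohozaev_lt (hB : 0 < B) (hε : 0 < ε)
    (H : RadialPair u p fun τ => powerNl A B ε (u τ))
    {x y : ℝ} (hx : 0 < x) (hxy : x < y) (hu : ∀ t ∈ Ioo x y, 0 < u t) :
    pohozaev A B ε u p y < pohozaev A B ε u p x := by
  have := lt_of_hasDerivAt_pos (g := fun t => -pohozaev A B ε u p t) hxy
    ((H.continuousOn_pohozaev hε).neg.mono fun t ht => hx.trans_le ht.1)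
    (fun t ht => (hasDerivAt_pohozaev hε H (hx.trans ht.1) (hu t ht)).neg)
    (fun t ht => by
      have h1 := hu t ht
      have h2 := Real.sinh_pos_iff.2 (hx.trans ht.1)
      have h3 := Real.cosh_pos t
      rw [neg_neg]
      positivity)
  linarith

end Signs

/-! ### Solutions that reach zero at a finite b. -/

section FirstZero

variable {A B ε : ℝ} {u p w r : ℝ → ℝ} {b : ℝ}

/-- J strictly decreases to J(b), where only the nonnegative p² term is left. -/
theorem RadialPair.pohozaev_pos_of_zero (hB : 0 < B) (hε : 0 < ε)
    (H : RadialPair u p fun τ => powerNl A B ε (u τ))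
    (hu : ∀ τ ∈ Ico 0 b, 0 < u τ) (hub : u b = 0) {τ : ℝ} (hτ : τ ∈ Ioo 0 b) :
    0 < pohozaev A B ε u p τ := by
  refine lt_of_le_of_lt ?_ (H.pohozaev_lt hB hε hτ.1 hτ.2
    fun t ht => hu t ⟨(hτ.1.trans ht.1).le, ht.2⟩)
  have hb : 0 < b := hτ.1.trans hτ.2
  have hs := Real.sinh_pos_iff.2 hb
  have h2 : 2 + ε ≠ 0 := by positivity
  simp only [pohozaev, hub, powerPot, abs_zero, Real.zero_rpow h2]
  simp only [zero_mul, mul_zero, add_zero, ne_eq, OfNat.ofNat_ne_zero, not_false_eq_true, zero_pow,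
    sub_zero]
  positivity

theorem RadialPair.snd_neg_of_zero (hB : 0 < B) (hε : 0 < ε)
    (H : RadialPair u p fun τ => powerNl A B ε (u τ))
    (hu : ∀ τ ∈ Ico 0 b, 0 < u τ) (hub : u b = 0) {τ : ℝ} (hτ : τ ∈ Ioo 0 b) : p τ < 0 := by
  refine H.snd_neg hB hε hu (fun t ht => ?_) hτ
  refine le_trans ?_ (H.radialEnergy_le hε ht.1 ht.2.le fun _ _ => rfl)
  have h2 : 2 + ε ≠ 0 := by positivity
  simp only [radialEnergy, hub, powerPot, abs_zero, Real.zero_rpow h2]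
  nlinarith [sq_nonneg (p b)]

theorem RadialPair.fst_anti {h : ℝ → ℝ} (H : RadialPair u p h) {x y : ℝ} (hx : 0 ≤ x) (hxy : x ≤ y)
    (hp : ∀ t ∈ Ioo x y, p t < 0) : u y ≤ u x := by
  have := le_of_hasDerivAt_nonneg (g := fun t => -u t) hxy (H.1.neg.mono fun t ht => hx.trans ht.1)
    (fun t ht => (H.4 t (hx.trans_lt ht.1)).neg) (fun t ht => by linarith [hp t ht])
  linarith

/-- This controls the singular term Δp/u of Y at b. The derivative of sinh · Δ is O(u^(1+ε)) and u
decreases, so Δ(t) = O(u(t)^(1+ε)(b - t)). Dividing by u(t) is harmless, and p(b) ≠ 0 is not needed.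
-/
theorem RadialPair.wronskian_div_tendsto_zero (hA : 0 < A) (hB : 0 < B) (hε : 0 < ε)
    (H : RadialPair u p fun τ => powerNl A B ε (u τ))
    (W : RadialPair w r fun τ => powerNlDeriv A B ε (u τ) * w τ) (hb : 0 < b)
    (hu : ∀ τ ∈ Ico 0 b, 0 < u τ) (hub : u b = 0) (hΔ : wronskian u p w r b = 0) :
    Tendsto (fun t => wronskian u p w r t / u t) (𝓝[<] b) (𝓝 0) := by
  obtain ⟨M, hM⟩ := isCompact_Icc.exists_bound_of_continuousOn (s := Icc (0 : ℝ) b)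
    (W.1.mono Icc_subset_Ici_self)
  have hM0 : 0 ≤ M := (norm_nonneg _).trans (hM 0 ⟨le_rfl, hb.le⟩)
  have hsb := Real.sinh_pos_iff.2 hb
  have hbound : ∀ t ∈ Ioo 0 b, ‖wronskian u p w r t / u t‖ ≤
      (Real.sinh t)⁻¹ * (Real.sinh b * (A * ε * |u t| ^ ε * M) * (b - t)) := by
    intro t ht
    have hst := Real.sinh_pos_iff.2 ht.1
    have hut := hu t ⟨ht.1.le, ht.2⟩
    have h1 := (convex_Icc t b).norm_image_sub_le_of_norm_hasDerivWithin_le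
      (f := fun t => Real.sinh t * wronskian u p w r t)
      (C := Real.sinh b * (A * ε * (|u t| ^ ε * u t) * M))
      (fun x hx => (H.hasDerivAt_sinh_mul_wronskian W (ht.1.trans_le hx.1)).hasDerivWithinAt)
      (fun x hx => by
        have hx0 := ht.1.trans_le hx.1
        have hsx := Real.sinh_pos_iff.2 hx0
        have hux : 0 ≤ u x := by
          rcases hx.2.eq_or_lt with h | h
          · rw [h, hub]
          · exact (hu x ⟨hx0.le, h⟩).le
        have hle : u x ≤ u t := H.fst_anti ht.1.le hx.1 fun y hy =>
          H.snd_neg_of_zero hB hε hu hub ⟨ht.1.trans hy.1, hy.2.trans_le hx.2⟩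
        have hw := hM x ⟨hx0.le, hx.2⟩
        rw [Real.norm_eq_abs] at hw ⊢
        have hnn : 0 ≤ |u x| ^ ε * u x := by positivity
        rw [abs_mul, abs_mul, abs_of_pos hsx, abs_of_nonneg (mul_nonneg (by positivity) hnn)]
        have : |u x| ≤ |u t| := by rwa [abs_of_nonneg hux, abs_of_pos hut]
        have := Real.sinh_le_sinh.2 hx.2
        gcongr)
      (right_mem_Icc.2 ht.2.le) (left_mem_Icc.2 ht.2.le)
    simp only [hΔ, mul_zero, sub_zero, Real.norm_eq_abs, abs_mul, abs_of_pos hst] at h1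
    rw [abs_of_neg (show t - b < 0 by linarith [ht.2])] at h1
    rw [norm_div, Real.norm_eq_abs, Real.norm_eq_abs (u t), abs_of_pos hut]
    rw [abs_of_pos hut] at h1
    rw [div_le_iff₀ hut, inv_mul_eq_div, div_mul_eq_mul_div, le_div_iff₀ hst]
    linarith
  refine squeeze_zero_norm' (by
    filter_upwards [Ioo_mem_nhdsLT hb] with t ht using hbound t ht) ?_
  have hc : ContinuousWithinAt (fun t => (Real.sinh t)⁻¹ *
      (Real.sinh b * (A * ε * |u t| ^ ε * M) * (b - t))) (Iio b) b := by
    have h1 : ContinuousWithinAt u (Iio b) b := (H.4 b hb).continuousAt.continuousWithinAt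
    have h2 : ContinuousWithinAt (fun t => |u t| ^ ε) (Iio b) b :=
      h1.abs.rpow_const (Or.inr hε.le)
    have h3 : ContinuousWithinAt (fun t => (Real.sinh t)⁻¹) (Iio b) b :=
      (Real.continuous_sinh.continuousWithinAt).inv₀ hsb.ne'
    exact h3.mul ((continuousWithinAt_const.mul ((continuousWithinAt_const.mul h2).mul
      continuousWithinAt_const)).mul (continuousWithinAt_const.sub continuousWithinAt_id))
  have := hc.tendsto
  simpa using this

/-- The variation at an initial value whose solution vanishes first at `b`. -/
theorem RadialPair.variation_of_zero (hA : 0 < A) (hB : 0 < B) (hε : 0 < ε)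
    (H : RadialPair u p fun τ => powerNl A B ε (u τ))
    (W : RadialPair w r fun τ => powerNlDeriv A B ε (u τ) * w τ) (hw0 : w 0 = 1) (hb : 0 < b)
    (hu : ∀ τ ∈ Ico 0 b, 0 < u τ) (hub : u b = 0) :
    (∃! τ, τ ∈ Ioo 0 b ∧ w τ = 0) ∧ w b < 0 := by
  have hJ := fun {τ : ℝ} (hτ : τ ∈ Ioo 0 b) => H.pohozaev_pos_of_zero hB hε hu hub hτ
  have hΔ := fun {τ : ℝ} (hτ : τ ∈ Ioo 0 b) => H.wronskian_pos hA hε W hw0 hu (fun _ h => hJ h) hτ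
  have hp := fun {τ : ℝ} (hτ : τ ∈ Ioo 0 b) => H.snd_neg_of_zero hB hε hu hub hτ
  have hNB : (𝓝[<] b).NeBot := inferInstance
  have hpb : p b ≤ 0 := by
    have h1 : Tendsto p (𝓝[<] b) (𝓝 (p b)) := (H.5 b hb).continuousAt.continuousWithinAt
    refine le_of_tendsto h1 ?_
    filter_upwards [Ioo_mem_nhdsLT hb] with t ht using (hp ht).le
  have hΔc : Tendsto (wronskian u p w r) (𝓝[<] b) (𝓝 (wronskian u p w r b)) :=
    (hasDerivAt_wronskian H W hb).continuousAt.continuousWithinAt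
  have hΔ0 : 0 ≤ wronskian u p w r b := by
    refine ge_of_tendsto hΔc ?_
    filter_upwards [Ioo_mem_nhdsLT hb] with t ht using (hΔ ht).le
  -- If Δ(b) = 0, every term of Y tends to 0 at b, although Y strictly decreases from Y(0) = 0.
  have hΔb : 0 < wronskian u p w r b := by
    refine lt_of_le_of_ne hΔ0 fun h0 => ?_
    have hanti : ∀ {x y : ℝ}, 0 ≤ x → x < y → y < b →
        pohozaevVariation A ε u p w r y < pohozaevVariation A ε u p w r x := by
      intro x y hx hxy hy
      exact H.pohozaevVariation_lt hε W hx hxy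
        (fun t ht => hu t ⟨hx.trans ht.1, ht.2.trans_lt hy⟩)
        (fun t ht => hJ ⟨hx.trans_lt ht.1, ht.2.trans hy⟩)
        fun t ht => hΔ ⟨hx.trans_lt ht.1, ht.2.trans hy⟩
    have hlim : Tendsto (fun t => Real.sinh t ^ (ε / (4 + ε)) *
        (Real.sinh t * p t * (wronskian u p w r t / u t) +
          2 / (4 + ε) * Real.cosh t * wronskian u p w r t -
          A * ε / (2 + ε) * (Real.sinh t * (w t * (|u t| ^ ε * u t))))) (𝓝[<] b) (𝓝 0) := by
      have c1 := (continuous_sinh_rpow hε).continuousWithinAt (s := Iio b) (x := b)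
      have c2 := Real.continuous_sinh.continuousWithinAt (s := Iio b) (x := b)
      have c3 := Real.continuous_cosh.continuousWithinAt (s := Iio b) (x := b)
      have c4 : ContinuousWithinAt p (Iio b) b := (H.5 b hb).continuousAt.continuousWithinAt
      have c5 : ContinuousWithinAt w (Iio b) b := (W.4 b hb).continuousAt.continuousWithinAt
      have c6 : ContinuousWithinAt u (Iio b) b := (H.4 b hb).continuousAt.continuousWithinAt
      have c7 : ContinuousWithinAt (fun t => |u t| ^ ε) (Iio b) b :=
        c6.abs.rpow_const (Or.inr hε.le)
      have hq := H.wronskian_div_tendsto_zero hA hB hε W hb hu hub h0.symm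
      have := c1.tendsto.mul ((((c2.mul c4).tendsto.mul hq).add
        ((c3.tendsto.const_mul (2 / (4 + ε))).mul hΔc)).sub
        ((c2.mul (c5.mul (c7.mul c6))).tendsto.const_mul (A * ε / (2 + ε))))
      simpa [hub, ← h0] using this
    have hY0 := hanti le_rfl (half_pos hb) (half_lt_self hb)
    rw [pohozaevVariation_zero hε] at hY0
    have : 0 ≤ pohozaevVariation A ε u p w r (b / 2) := by
      refine le_of_tendsto hlim ?_
      filter_upwards [Ioo_mem_nhdsLT (half_lt_self hb)] with t ht
      have h1 := hanti (half_pos hb).le ht.1 ht.2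
      refine le_trans (le_of_eq ?_) h1.le
      rw [pohozaevVariation]
      ring
    linarith
  have hwb : w b < 0 := by
    rw [wronskian, hub, zero_mul, sub_zero] at hΔb
    exact neg_of_mul_pos_right hΔb hpb
  obtain ⟨e, he, hwe, -⟩ := exists_first_zero hb.le (W.1.mono Icc_subset_Ici_self)
    (by rw [hw0]; exact one_pos) hwb.le
  have heb : e ∈ Ioo 0 b := ⟨he.1, lt_of_le_of_ne he.2 fun h => by rw [h] at hwe; linarith⟩
  exact ⟨⟨e, ⟨heb, hwe⟩, fun y hy => H.eq_of_variation_eq_zero W hu (fun _ h => hΔ h) hy.1 heb hy.2 hwe⟩,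
    hwb⟩

end FirstZero

/-! ### Ground states: decay, and the variation at infinity. -/

section Ground

variable {A B ε : ℝ} {u p w r : ℝ → ℝ}

theorem tendsto_sinh_atTop : Tendsto Real.sinh atTop atTop :=
  tendsto_atTop_mono' atTop (by
    filter_upwards [eventually_ge_atTop 0] with t ht using Real.self_le_sinh_iff.2 ht) tendsto_id

theorem tendsto_sinh_rpow_div_sinh (hε : 0 < ε) :
    Tendsto (fun t => Real.sinh t ^ (ε / (4 + ε)) / Real.sinh t) atTop (𝓝 0) := by
  have h1 : 0 < 1 - ε / (4 + ε) := by
    rw [sub_pos, div_lt_one (by positivity)]; linarith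
  refine ((tendsto_rpow_neg_atTop h1).comp tendsto_sinh_atTop).congr' ?_
  filter_upwards [eventually_gt_atTop 0] with t ht
  have hs := Real.sinh_pos_iff.2 ht
  rw [Function.comp_apply, neg_sub, Real.rpow_sub_one hs.ne']

theorem cosh_le_two_mul_sinh {t : ℝ} (h : 1 ≤ Real.sinh t) : Real.cosh t ≤ 2 * Real.sinh t := by
  have := cosh_sq_sub t
  nlinarith [Real.cosh_pos t]

/-- A function which tends to zero and whose derivative is at least `-C / sinh` is at most
`C / sinh`. -/
theorem le_div_sinh_of_tendsto {y y' : ℝ → ℝ} {T C : ℝ} (hT : 0 < T) (hC : 0 ≤ C)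
    (hd : ∀ t, T ≤ t → HasDerivAt y (y' t) t) (hy' : ∀ t, T ≤ t → -C ≤ Real.sinh t * y' t)
    (hlim : Tendsto y atTop (𝓝 0)) {t : ℝ} (ht : T ≤ t) : y t ≤ C / Real.sinh t := by
  have hdd : ∀ x, T ≤ x → HasDerivAt (fun x => y x - C / Real.sinh x)
      (y' x - C * (-Real.cosh x / Real.sinh x ^ 2)) x := fun x hx =>
    (hd x hx).sub (((Real.hasDerivAt_sinh x).inv
      (Real.sinh_pos_iff.2 (hT.trans_le hx)).ne').const_mul C)
  -- As cosh ≥ sinh, the derivative of C/sinh is at most -C/sinh; the difference is therefore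
  -- nondecreasing, with limit 0.
  have hmono : ∀ x, t ≤ x → y t - C / Real.sinh t ≤ y x - C / Real.sinh x := by
    intro x hx
    refine le_of_hasDerivAt_nonneg (g := fun x => y x - C / Real.sinh x) hx
      (fun z hz => (hdd z (ht.trans hz.1)).continuousAt.continuousWithinAt)
      (fun z hz => hdd z (ht.trans hz.1.le)) fun z hz => ?_
    have hTz := ht.trans hz.1.le
    have hs := Real.sinh_pos_iff.2 (hT.trans_le hTz)
    have h1 := hy' z hTz
    have h2 := (Real.sinh_lt_cosh z).le
    have h3 : y' z - C * (-Real.cosh z / Real.sinh z ^ 2) =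
        (Real.sinh z * (Real.sinh z * y' z) + C * Real.cosh z) / Real.sinh z ^ 2 := by
      field_simp
      ring
    rw [h3]
    refine div_nonneg ?_ (by positivity)
    nlinarith [mul_le_mul_of_nonneg_left h1 hs.le, mul_le_mul_of_nonneg_left h2 hC]
  have hl : Tendsto (fun x => y x - C / Real.sinh x) atTop (𝓝 0) := by
    simpa using hlim.sub (tendsto_sinh_atTop.const_div_atTop C)
  have := ge_of_tendsto hl ((eventually_ge_atTop t).mono hmono)
  linarith

theorem tendsto_powerPot (hε : 0 < ε) (h0 : Tendsto u atTop (𝓝 0)) :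
    Tendsto (fun t => powerPot A B ε (u t)) atTop (𝓝 0) := by
  have h2 : 2 + ε ≠ 0 := by positivity
  have := ((continuous_powerPot (A := A) (B := B) hε).tendsto 0).comp h0
  have hz : powerPot A B ε 0 = 0 := by simp [powerPot, Real.zero_rpow h2]
  rwa [hz] at this

theorem RadialPair.snd_neg_of_tendsto (hB : 0 < B) (hε : 0 < ε)
    (H : RadialPair u p fun τ => powerNl A B ε (u τ)) (hu : ∀ τ, 0 ≤ τ → 0 < u τ)
    (h0 : Tendsto u atTop (𝓝 0)) {τ : ℝ} (hτ : 0 < τ) : p τ < 0 := by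
  refine H.snd_neg (b := τ + 1) hB hε (fun t ht => hu t ht.1) (fun t ht => ?_)
    ⟨hτ, lt_add_one τ⟩
  refine le_of_tendsto (tendsto_powerPot (A := A) (B := B) hε h0) ?_
  filter_upwards [eventually_ge_atTop t] with x hx
  have := H.radialEnergy_le (A := A) (B := B) hε ht.1 hx fun _ _ => rfl
  refine le_trans ?_ this
  rw [radialEnergy]
  linarith [sq_nonneg (p x)]

theorem powerNl_le_of_small (hA : 0 < A) (hε : 0 < ε) {x : ℝ} (hx : 0 < x)
    (h : A * (1 + ε) * |x| ^ ε ≤ B / 2) : powerNl A B ε x ≤ -(B / 2) * x := by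
  have h1 : 0 ≤ A * ε * |x| ^ ε := by positivity
  rw [powerNl]
  nlinarith

/-- Once u is small, f(u) < 0 and sinh · p is nondecreasing, so its value at T bounds it below;
integrating from infinity gives the decay of u. The smallness clause makes f' ≤ -B/2 on the tail. -/
theorem RadialPair.exists_decay (hA : 0 < A) (hB : 0 < B) (hε : 0 < ε)
    (H : RadialPair u p fun τ => powerNl A B ε (u τ)) (hu : ∀ τ, 0 ≤ τ → 0 < u τ)
    (h0 : Tendsto u atTop (𝓝 0)) :
    ∃ T C, 0 < T ∧ 0 < C ∧ ∀ t, T ≤ t → 1 ≤ Real.sinh t ∧ A * (1 + ε) * |u t| ^ ε ≤ B / 2 ∧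
      Real.sinh t * u t ≤ C ∧ -C ≤ Real.sinh t * p t := by
  have hsmall : ∀ᶠ t in atTop, A * (1 + ε) * |u t| ^ ε ≤ B / 2 := by
    have hc : Continuous fun y : ℝ => A * (1 + ε) * |y| ^ ε :=
      continuous_const.mul (continuous_abs.rpow_const fun _ => Or.inr hε.le)
    have := (hc.tendsto 0).comp h0
    rw [abs_zero, Real.zero_rpow hε.ne', mul_zero] at this
    exact (this.eventually (gt_mem_nhds (half_pos hB))).mono fun _ h => le_of_lt h
  obtain ⟨T, hT⟩ := eventually_atTop.1 ((hsmall.and (tendsto_sinh_atTop.eventually_ge_atTop 1)).and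
    (eventually_gt_atTop 0))
  have hT0 : 0 < T := (hT T le_rfl).2
  have hsT : 1 ≤ Real.sinh T := (hT T le_rfl).1.2
  have hpT := H.snd_neg_of_tendsto hB hε hu h0 hT0
  have hq : ∀ t, T ≤ t → -(-(Real.sinh T * p T)) ≤ Real.sinh t * p t := by
    intro t ht
    rw [neg_neg]
    refine le_of_hasDerivAt_nonneg ht (H.continuousOn_sinh_mul.mono fun x hx => hT0.le.trans hx.1)
      (fun x hx => H.hasDerivAt_sinh_mul (hT0.trans hx.1)) fun x hx => ?_
    have h1 := powerNl_le_of_small hA hε (hu x (hT0.trans hx.1).le) (hT x hx.1.le).1.1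
    have h2 := hu x (hT0.trans hx.1).le
    have h3 := Real.sinh_pos_iff.2 (hT0.trans hx.1)
    have h4 : 0 < B / 2 * u x := by positivity
    nlinarith
  refine ⟨T, -(Real.sinh T * p T), hT0, by nlinarith, fun t ht =>
    ⟨(hT t ht).1.2, (hT t ht).1.1, ?_, hq t ht⟩⟩
  have := le_div_sinh_of_tendsto hT0 (by nlinarith) (fun t ht => H.4 t (hT0.trans_le ht)) hq h0 ht
  rw [le_div_iff₀ (by linarith [(hT t ht).1.2])] at this
  linarith

/-- The decay gives J ≥ -const · sinh^(κ-1) with κ = ε/(4 + ε) < 1. The right side tends to 0 and J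
strictly decreases. -/
theorem RadialPair.pohozaev_pos_of_tendsto (hA : 0 < A) (hB : 0 < B) (hε : 0 < ε)
    (H : RadialPair u p fun τ => powerNl A B ε (u τ)) (hu : ∀ τ, 0 ≤ τ → 0 < u τ)
    (h0 : Tendsto u atTop (𝓝 0)) {τ : ℝ} (hτ : 0 < τ) : 0 < pohozaev A B ε u p τ := by
  obtain ⟨T, C, hT, hC, hdec⟩ := H.exists_decay hA hB hε hu h0
  suffices h : ∀ t, 0 < t → 0 ≤ pohozaev A B ε u p t from
    (h (τ + 1) (by positivity)).trans_lt
      (H.pohozaev_lt hB hε hτ (lt_add_one τ) fun t ht => hu t (hτ.trans ht.1).le)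
  intro t ht
  have hlim : Tendsto (fun t => -(C ^ 2 * (2 + B)) *
      (Real.sinh t ^ (ε / (4 + ε)) / Real.sinh t)) atTop (𝓝 0) := by
    simpa using (tendsto_sinh_rpow_div_sinh hε).const_mul (-(C ^ 2 * (2 + B)))
  refine le_of_tendsto hlim ?_
  filter_upwards [eventually_ge_atTop T, eventually_gt_atTop t] with x hx htx
  refine le_trans ?_ (H.pohozaev_lt hB hε ht htx fun y hy => hu y (ht.trans hy.1).le).le
  obtain ⟨hs1, -, hux, hpx⟩ := hdec x hx
  have hch := cosh_le_two_mul_sinh hs1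
  have hs : 0 < Real.sinh x := by linarith
  have hup := hu x (hT.trans_le hx).le
  have hpn := H.snd_neg_of_tendsto hB hε hu h0 (hT.trans_le hx)
  have hcp := Real.cosh_pos x
  have hσ : 0 < Real.sinh x ^ (ε / (4 + ε)) := Real.rpow_pos_of_pos hs _
  rw [pohozaev, neg_mul, ← mul_div_assoc, mul_comm _ (Real.sinh x ^ (ε / (4 + ε))),
    mul_div_assoc, ← mul_neg]
  refine mul_le_mul_of_nonneg_left ?_ hσ.le
  rw [neg_le_iff_add_nonneg, ← mul_nonneg_iff_of_pos_left hs]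
  have e1 : Real.sinh x * (Real.sinh x * p x ^ 2 / 2 +
      2 / (4 + ε) * (Real.cosh x * (u x * p x)) +
      1 / (4 + ε) * (4 / (4 + ε) / Real.sinh x - ε / (4 + ε) * Real.sinh x) * u x ^ 2 +
      Real.sinh x * powerPot A B ε (u x) + C ^ 2 * (2 + B) / Real.sinh x) =
      (Real.sinh x * p x) ^ 2 / 2 - 2 / (4 + ε) * (Real.cosh x * (u x * -(Real.sinh x * p x))) +
      4 / (4 + ε) ^ 2 * u x ^ 2 - ε / (4 + ε) ^ 2 * (Real.sinh x * u x) ^ 2 +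
      (Real.sinh x ^ 2 * powerPot A B ε (u x) + C ^ 2 * (2 + B)) := by
    field_simp
    ring
  rw [e1]
  have hsu : 0 < Real.sinh x * u x := by positivity
  have hsu2 : (Real.sinh x * u x) ^ 2 ≤ C ^ 2 := by gcongr
  have f1 : 2 / (4 + ε) * (Real.cosh x * (u x * -(Real.sinh x * p x))) ≤ C ^ 2 := by
    have g1 : Real.cosh x * (u x * -(Real.sinh x * p x)) ≤ 2 * C ^ 2 := by
      have : 0 ≤ -(Real.sinh x * p x) := by nlinarith
      calc Real.cosh x * (u x * -(Real.sinh x * p x))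
          ≤ (2 * Real.sinh x) * (u x * C) := by
            gcongr
            linarith
        _ = 2 * ((Real.sinh x * u x) * C) := by ring
        _ ≤ 2 * (C * C) := by gcongr
        _ = _ := by ring
    have g2 : 2 / (4 + ε) ≤ 1 / 2 := by
      rw [div_le_div_iff₀ (by positivity) (by norm_num)]; linarith
    calc _ ≤ 2 / (4 + ε) * (2 * C ^ 2) := by gcongr
      _ ≤ 1 / 2 * (2 * C ^ 2) := by gcongr
      _ = _ := by ring
  have f2 : ε / (4 + ε) ^ 2 * (Real.sinh x * u x) ^ 2 ≤ C ^ 2 := by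
    have : ε / (4 + ε) ^ 2 ≤ 1 := by
      rw [div_le_one (by positivity)]; nlinarith
    calc _ ≤ 1 * C ^ 2 := by gcongr
      _ = _ := one_mul _
  have f3 : -(B * C ^ 2) ≤ Real.sinh x ^ 2 * powerPot A B ε (u x) := by
    rw [powerPot_of_pos hup]
    have g1 : 0 ≤ A / (2 + ε) * (|u x| ^ ε * u x ^ 2) := by positivity
    have g2 : 0 ≤ Real.sinh x ^ 2 * (A / (2 + ε) * (|u x| ^ ε * u x ^ 2)) := by positivity
    nlinarith
  have f4 : 0 ≤ 4 / (4 + ε) ^ 2 * u x ^ 2 := by positivity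
  nlinarith [sq_nonneg (Real.sinh x * p x)]

theorem RadialPair.wronskian_pos_of_tendsto (hA : 0 < A) (hB : 0 < B) (hε : 0 < ε)
    (H : RadialPair u p fun τ => powerNl A B ε (u τ))
    (W : RadialPair w r fun τ => powerNlDeriv A B ε (u τ) * w τ) (hw0 : w 0 = 1)
    (hu : ∀ τ, 0 ≤ τ → 0 < u τ) (h0 : Tendsto u atTop (𝓝 0)) {τ : ℝ} (hτ : 0 < τ) :
    0 < wronskian u p w r τ :=
  H.wronskian_pos hA hε W hw0 (b := τ + 1) (fun t ht => hu t ht.1)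
    (fun _ ht => H.pohozaev_pos_of_tendsto hA hB hε hu h0 ht.1) ⟨hτ, lt_add_one τ⟩

/-- If w > 0 throughout, sinh · Δ is nondecreasing, so Δ ≥ D/sinh. Together with sinh · u ≤ C and
sinh ≥ 1 this makes (w/u)' ≤ -D/C², and w/u becomes negative. -/
theorem RadialPair.exists_nonpos_variation (hA : 0 < A) (hB : 0 < B) (hε : 0 < ε)
    (H : RadialPair u p fun τ => powerNl A B ε (u τ))
    (W : RadialPair w r fun τ => powerNlDeriv A B ε (u τ) * w τ) (hw0 : w 0 = 1)
    (hu : ∀ τ, 0 ≤ τ → 0 < u τ) (h0 : Tendsto u atTop (𝓝 0)) : ∃ τ, 0 < τ ∧ w τ ≤ 0 := by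
  by_contra! hcon
  obtain ⟨T, C, hT, hC, hdec⟩ := H.exists_decay hA hB hε hu h0
  set D : ℝ := Real.sinh T * wronskian u p w r T with hD
  have hD0 : 0 < D :=
    mul_pos (Real.sinh_pos_iff.2 hT) (H.wronskian_pos_of_tendsto hA hB hε W hw0 hu h0 hT)
  have hDle : ∀ t, T ≤ t → D ≤ Real.sinh t * wronskian u p w r t := fun t ht =>
    le_of_hasDerivAt_nonneg (g := fun t => Real.sinh t * wronskian u p w r t) ht
      ((Real.continuous_sinh.continuousOn.mul (H.continuousOn_wronskian W)).mono
        fun x hx => hT.le.trans hx.1)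
      (fun x hx => H.hasDerivAt_sinh_mul_wronskian W (hT.trans hx.1))
      fun x hx => by
        have hx0 := hT.trans hx.1
        have h1 := hcon x hx0
        have h2 := hu x hx0.le
        have h3 := Real.sinh_pos_iff.2 hx0
        positivity
  have hlin : ∀ t, T ≤ t → w t / u t ≤ w T / u T - D / C ^ 2 * (t - T) := by
    intro t ht
    have := le_of_hasDerivAt_nonneg (g := fun t => -(D / C ^ 2 * (t - T)) - w t / u t)
      (g' := fun t => -(D / C ^ 2) + wronskian u p w r t / u t ^ 2) ht
      ((Continuous.continuousOn (by fun_prop)).sub ((W.1.mono fun x hx => hT.le.trans hx.1).div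
        (H.1.mono fun x hx => hT.le.trans hx.1) fun x hx => (hu x (hT.le.trans hx.1)).ne'))
      (fun x hx => by
        have hx0 := hT.trans hx.1
        refine HasDerivAt.congr_deriv (((((hasDerivAt_id x).sub_const T).const_mul
          (D / C ^ 2)).neg).sub ((W.4 x hx0).div (H.4 x hx0) (hu x hx0.le).ne')) ?_
        rw [wronskian]
        ring)
      (fun x hx => by
        have hx0 := hT.trans hx.1
        have h1 := hDle x hx.1.le
        obtain ⟨h2, -, h3, -⟩ := hdec x hx.1.le
        have h4 := hu x hx0.le
        have h5 : D / C ^ 2 ≤ wronskian u p w r x / u x ^ 2 := by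
          rw [div_le_div_iff₀ (by positivity) (by positivity)]
          have h6 : (Real.sinh x * u x) ^ 2 ≤ C ^ 2 := by gcongr
          have h7 : 0 < wronskian u p w r x := H.wronskian_pos_of_tendsto hA hB hε W hw0 hu h0 hx0
          calc D * u x ^ 2 ≤ Real.sinh x * wronskian u p w r x * u x ^ 2 := by gcongr
            _ ≤ Real.sinh x * (Real.sinh x * wronskian u p w r x) * u x ^ 2 := by
                have : 0 ≤ Real.sinh x * wronskian u p w r x := by positivity
                gcongr
                nlinarith
            _ = wronskian u p w r x * (Real.sinh x * u x) ^ 2 := by ring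
            _ ≤ _ := by gcongr
        linarith)
    simp only [sub_self, mul_zero, neg_zero, zero_sub] at this
    linarith
  -- The time at which the linear upper bound for w/u equals -1.
  set t : ℝ := T + (w T / u T + 1) * C ^ 2 / D with ht
  have hwT : 0 < w T / u T := div_pos (hcon T hT) (hu T hT.le)
  have hTt : T ≤ t := by
    rw [ht]
    have : 0 ≤ (w T / u T + 1) * C ^ 2 / D := by positivity
    linarith
  have h1 := hlin t hTt
  have h2 : D / C ^ 2 * (t - T) = w T / u T + 1 := by rw [ht]; field_simp; ring
  have h3 : 0 < w t / u t := div_pos (hcon t (hT.trans_le hTt)) (hu t (hT.trans_le hTt).le)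
  linarith

/-- On the tail p²/2 + F(u) + 2up is nondecreasing, because coth ≤ 2 and f(u) < 0, and it is bounded
above by quantities tending to 0. Hence p²/2 ≤ 2u|p| + Bu²/2, for which B + 5 is a generous
constant. It bounds the quotient p/u in Y. -/
theorem RadialPair.abs_snd_le (hA : 0 < A) (hB : 0 < B) (hε : 0 < ε)
    (H : RadialPair u p fun τ => powerNl A B ε (u τ)) (hu : ∀ τ, 0 ≤ τ → 0 < u τ)
    (h0 : Tendsto u atTop (𝓝 0)) {T C : ℝ} (hT : 0 < T) (hdec : ∀ t, T ≤ t →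
      1 ≤ Real.sinh t ∧ A * (1 + ε) * |u t| ^ ε ≤ B / 2 ∧ -C ≤ Real.sinh t * p t)
    {t : ℝ} (ht : T ≤ t) : -p t ≤ (B + 5) * u t := by
  have hmono : ∀ x, t ≤ x → radialEnergy A B ε u p t + 2 * (u t * p t) ≤
      radialEnergy A B ε u p x + 2 * (u x * p x) := by
    intro x hx
    refine le_of_hasDerivAt_nonneg (g := fun x => radialEnergy A B ε u p x + 2 * (u x * p x)) hx
      (((H.continuousOn_radialEnergy hε).add (continuousOn_const.mul (H.1.mul H.2))).mono
        fun z hz => (hT.le.trans ht).trans hz.1)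
      (fun z hz => (H.hasDerivAt_radialEnergy hε (hT.trans_le (ht.trans hz.1.le)) rfl).add
        (((H.4 z (hT.trans_le (ht.trans hz.1.le))).mul
          (H.5 z (hT.trans_le (ht.trans hz.1.le)))).const_mul 2)) fun z hz => ?_
    have hTz := ht.trans hz.1.le
    have hz0 := hT.trans_le hTz
    obtain ⟨h1, h2, -⟩ := hdec z hTz
    have hc : Real.cosh z / Real.sinh z ≤ 2 := by
      rw [div_le_iff₀ (by linarith)]; exact cosh_le_two_mul_sinh h1
    have hc0 : 0 < Real.cosh z / Real.sinh z := div_pos (Real.cosh_pos z) (by linarith)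
    have hf := powerNl_le_of_small hA hε (hu z hz0.le) h2
    have huz := hu z hz0.le
    have hpz := H.snd_neg_of_tendsto hB hε hu h0 hz0
    have e1 : 0 ≤ (2 - Real.cosh z / Real.sinh z) * p z ^ 2 :=
      mul_nonneg (by linarith) (sq_nonneg _)
    have e2 : 0 ≤ Real.cosh z / Real.sinh z * (u z * -p z) :=
      mul_nonneg hc0.le (mul_nonneg huz.le (by linarith))
    have e3 : 0 ≤ u z * -powerNl A B ε (u z) :=
      mul_nonneg huz.le (by nlinarith)
    nlinarith
  have hlim : Tendsto (fun x => (C / Real.sinh x) ^ 2 / 2 + powerPot A B ε (u x)) atTop (𝓝 0) := by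
    have h1 := (((tendsto_sinh_atTop.const_div_atTop C).pow 2).div_const 2).add
      (tendsto_powerPot (A := A) (B := B) hε h0)
    simpa using h1
  have hQ : radialEnergy A B ε u p t + 2 * (u t * p t) ≤ 0 := by
    refine ge_of_tendsto hlim ?_
    filter_upwards [eventually_ge_atTop t] with x hx
    refine (hmono x hx).trans ?_
    have hx0 := hT.trans_le (ht.trans hx)
    have hux := hu x hx0.le
    have hpx := H.snd_neg_of_tendsto hB hε hu h0 hx0
    obtain ⟨h1, -, h2⟩ := hdec x (ht.trans hx)
    have hs : 0 < Real.sinh x := by linarith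
    have h3 : -p x ≤ C / Real.sinh x := by rw [le_div_iff₀ hs]; linarith
    have h4 : p x ^ 2 ≤ (C / Real.sinh x) ^ 2 := by
      rw [← neg_sq]
      have : 0 ≤ -p x := by linarith
      gcongr
    rw [radialEnergy]
    nlinarith [mul_pos hux (neg_pos.2 hpx)]
  have ht0 := hT.trans_le ht
  have hut := hu t ht0.le
  rw [radialEnergy, powerPot_of_pos hut] at hQ
  have h1 : 0 ≤ A / (2 + ε) * (|u t| ^ ε * u t ^ 2) := by positivity
  by_contra hcon
  push Not at hcon
  have h2 : (B + 5) * u t * -p t < -p t * -p t := by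
    have : 0 < -p t := lt_trans (by positivity) hcon
    gcongr
  have h3 : u t * ((B + 5) * u t) ≤ u t * -p t := by gcongr
  nlinarith [mul_pos hut hut]

/-- With f'(u) ≤ -B/2 and w ≤ -ω, (sinh · r)' ≤ -(Bω/2) sinh. So r is eventually at most -Bω/4, and
w falls at least linearly. -/
theorem RadialPair.tendsto_atBot_of_le (hB : 0 < B)
    (W : RadialPair w r fun τ => powerNlDeriv A B ε (u τ) * w τ) {T ω : ℝ} (hT : 0 < T)
    (hω : 0 < ω) (hsmall : ∀ t, T ≤ t → A * (1 + ε) * |u t| ^ ε ≤ B / 2)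
    (hw : ∀ t, T ≤ t → w t ≤ -ω) : Tendsto w atTop atBot := by
  set K : ℝ := Real.sinh T * r T + B / 2 * ω * Real.cosh T with hK
  have hr : ∀ t, T ≤ t → Real.sinh t * r t + B / 2 * ω * Real.cosh t ≤ K := by
    intro t ht
    have := le_of_hasDerivAt_nonneg
      (g := fun t => -(Real.sinh t * r t + B / 2 * ω * Real.cosh t)) ht
      (((W.continuousOn_sinh_mul).mono fun x hx => hT.le.trans hx.1).add
        (Continuous.continuousOn (by fun_prop))).neg
      (fun x hx => ((W.hasDerivAt_sinh_mul (hT.trans hx.1)).add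
        ((Real.hasDerivAt_cosh x).const_mul (B / 2 * ω))).neg)
      (fun x hx => by
        have hs := Real.sinh_pos_iff.2 (hT.trans hx.1)
        have h1 := hsmall x hx.1.le
        have h2 := hw x hx.1.le
        have h3 : B / 2 * ω ≤ powerNlDeriv A B ε (u x) * w x := by
          rw [powerNlDeriv]
          nlinarith
        nlinarith)
    linarith
  have hev : ∀ᶠ t in atTop, r t ≤ -(B * ω / 4) := by
    filter_upwards [eventually_ge_atTop T, tendsto_sinh_atTop.eventually_ge_atTop
      (|K| / (B * ω / 4)), eventually_gt_atTop 0] with t h1 h2 h3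
    have hs := Real.sinh_pos_iff.2 h3
    rw [div_le_iff₀ (by positivity)] at h2
    have h4 := hr t h1
    have h5 := (Real.sinh_lt_cosh t).le
    have h6 : B / 2 * ω * Real.sinh t ≤ B / 2 * ω * Real.cosh t := by gcongr
    have h7 := le_abs_self K
    have h8 : Real.sinh t * r t ≤ Real.sinh t * -(B * ω / 4) := by linarith
    exact le_of_mul_le_mul_left h8 hs
  obtain ⟨S, hS⟩ := eventually_atTop.1 (hev.and (eventually_gt_atTop 0))
  have hS0 : 0 < S := (hS S le_rfl).2
  have hlin : ∀ t, S ≤ t → w t ≤ w S + B * ω / 4 * S + -(B * ω / 4) * t := by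
    intro t ht
    have := le_of_hasDerivAt_nonneg (g := fun t => -(B * ω / 4) * t - w t) ht
      ((Continuous.continuousOn (by fun_prop)).sub (W.1.mono fun x hx => hS0.le.trans hx.1))
      (fun x hx => ((hasDerivAt_id x).const_mul (-(B * ω / 4))).sub (W.4 x (hS0.trans hx.1)))
      (fun x hx => by
        have := (hS x hx.1.le).1
        linarith)
    linarith
  refine tendsto_atBot_mono' atTop ((eventually_ge_atTop S).mono hlin) ?_
  exact tendsto_atBot_add_const_left _ _
    (tendsto_id.const_mul_atTop_of_neg (by have : 0 < B * ω / 4 := by positivity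
                                           linarith))

/-- The variation at the initial value of a ground state. -/
theorem RadialPair.variation_of_tendsto (hA : 0 < A) (hB : 0 < B) (hε : 0 < ε)
    (H : RadialPair u p fun τ => powerNl A B ε (u τ))
    (W : RadialPair w r fun τ => powerNlDeriv A B ε (u τ) * w τ) (hw0 : w 0 = 1)
    (hu : ∀ τ, 0 ≤ τ → 0 < u τ) (h0 : Tendsto u atTop (𝓝 0)) :
    (∃! τ, τ ∈ Ioi 0 ∧ w τ = 0) ∧ Tendsto w atTop atBot := by
  have hΔ := fun {τ : ℝ} (hτ : 0 < τ) => H.wronskian_pos_of_tendsto hA hB hε W hw0 hu h0 hτ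
  obtain ⟨τ₁, hτ₁, hwτ₁⟩ := H.exists_nonpos_variation hA hB hε W hw0 hu h0
  obtain ⟨c, hc, hwc, -⟩ := exists_first_zero hτ₁.le (W.1.mono Icc_subset_Ici_self)
    (by rw [hw0]; exact one_pos) hwτ₁
  have hc0 : 0 < c := hc.1
  refine ⟨⟨c, ⟨hc0, hwc⟩, fun y hy => ?_⟩, ?_⟩
  · exact H.eq_of_variation_eq_zero W (b := max y c + 1) (fun t ht => hu t ht.1) (fun t ht => hΔ ht.1)
      ⟨hy.1, by linarith [le_max_left y c]⟩ ⟨hc0, by linarith [le_max_right y c]⟩ hy.2 hwc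
  have hneg : ∀ t, c < t → w t < 0 := by
    intro t ht
    have := H.div_strictAntiOn W (b := t + 1) (fun t ht => hu t ht.1) (fun t ht => hΔ ht.1)
      ⟨hc0.le, by linarith⟩ ⟨(hc0.trans ht).le, lt_add_one t⟩ ht
    simp only [hwc, zero_div] at this
    exact (div_neg_iff.1 this).resolve_left (fun h => absurd h.2 (not_lt.2 (hu t
      (hc0.trans ht).le).le)) |>.1
  obtain ⟨T₀, C, hT₀, hC, hdec⟩ := H.exists_decay hA hB hε hu h0
  set T : ℝ := max T₀ (c + 1) with hTdef
  have hT : 0 < T := hT₀.trans_le (le_max_left _ _)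
  have hTT : ∀ {t : ℝ}, T ≤ t → T₀ ≤ t := fun h => (le_max_left _ _).trans h
  have hTc : ∀ {t : ℝ}, T ≤ t → c < t := fun h =>
    (lt_add_one c).trans_le ((le_max_right _ _).trans h)
  have hsmall : ∀ t, T ≤ t → A * (1 + ε) * |u t| ^ ε ≤ B / 2 := fun t ht => (hdec t (hTT ht)).2.1
  have hranti : ∀ {x y : ℝ}, T ≤ x → x ≤ y → Real.sinh y * r y ≤ Real.sinh x * r x := by
    intro x y hx hxy
    have := le_of_hasDerivAt_nonneg (g := fun t => -(Real.sinh t * r t)) hxy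
      (W.continuousOn_sinh_mul.neg.mono fun t ht => (hT.le.trans hx).trans ht.1)
      (fun t ht => (W.hasDerivAt_sinh_mul (hT.trans_le (hx.trans ht.1.le))).neg)
      (fun t ht => by
        have hTt := hx.trans ht.1.le
        have h1 := hsmall t hTt
        have h2 := hneg t (hTc hTt)
        have h3 := Real.sinh_pos_iff.2 (hT.trans_le hTt)
        rw [neg_neg]
        refine mul_nonneg h3.le (mul_nonneg_of_nonpos_of_nonpos ?_ h2.le)
        rw [powerNlDeriv]
        linarith)
    linarith
  -- sinh · r is nonincreasing on the tail, so one negative value of r keeps w below a negative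
  -- level. Otherwise w is nondecreasing, and either stays below some -ω or tends to 0.
  by_cases hcase : ∃ T₁, T ≤ T₁ ∧ r T₁ < 0
  · obtain ⟨T₁, hTT₁, hrT₁⟩ := hcase
    have hT₁0 := hT.trans_le hTT₁
    refine W.tendsto_atBot_of_le hB hT₁0 (ω := -w T₁) (by linarith [hneg T₁ (hTc hTT₁)])
      (fun t ht => hsmall t (hTT₁.trans ht)) fun t ht => ?_
    rw [neg_neg]
    refine W.fst_anti hT₁0.le ht fun x hx => ?_
    have h1 := hranti hTT₁ hx.1.le
    have h2 := Real.sinh_pos_iff.2 (hT₁0.trans hx.1)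
    have h3 := mul_neg_of_pos_of_neg (Real.sinh_pos_iff.2 hT₁0) hrT₁
    exact neg_of_mul_neg_right (h1.trans_lt h3) h2.le
  push Not at hcase
  have hwmono : ∀ {x y : ℝ}, T ≤ x → x ≤ y → w x ≤ w y := fun hx hxy =>
    le_of_hasDerivAt_nonneg hxy (W.1.mono fun t ht => (hT.le.trans hx).trans ht.1)
      (fun t ht => W.4 t (hT.trans_le (hx.trans ht.1.le))) fun t ht => hcase t (hx.trans ht.1.le)
  by_cases hω : ∃ ω, 0 < ω ∧ ∀ t, T ≤ t → w t ≤ -ω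
  · obtain ⟨ω, hω, h⟩ := hω
    exact W.tendsto_atBot_of_le hB hT hω hsmall h
  push Not at hω
  -- If w → 0 then |w| = O(1/sinh), so Y ≥ -const · sinh^(κ-1) → 0. But Y is strictly decreasing
  -- with Y(1) < 0.
  exfalso
  have hwlim : Tendsto (fun t => -w t) atTop (𝓝 0) := by
    rw [Metric.tendsto_atTop]
    intro η hη
    obtain ⟨t, ht, hwt⟩ := hω η hη
    refine ⟨t, fun x hx => ?_⟩
    have h1 := hwmono ht hx
    have h2 := hneg x (hTc (ht.trans hx))
    rw [Real.dist_eq, sub_zero, abs_neg, abs_of_neg h2]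
    linarith
  set C₂ : ℝ := Real.sinh T * r T with hC₂
  have hC₂0 : 0 ≤ C₂ := mul_nonneg (Real.sinh_pos_iff.2 hT).le (hcase T le_rfl)
  have hwle : ∀ t, T ≤ t → -w t ≤ C₂ / Real.sinh t := fun t ht =>
    le_div_sinh_of_tendsto hT hC₂0 (fun t ht => (W.4 t (hT.trans_le ht)).neg)
      (fun t ht => by
        have := hranti le_rfl ht
        linarith) hwlim ht
  have hY : ∀ {x y : ℝ}, 0 ≤ x → x < y →
      pohozaevVariation A ε u p w r y < pohozaevVariation A ε u p w r x := fun hx hxy =>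
    H.pohozaevVariation_lt hε W hx hxy (fun t ht => hu t (hx.trans ht.1))
      (fun t ht => H.pohozaev_pos_of_tendsto hA hB hε hu h0 (hx.trans_lt ht.1))
      fun t ht => hΔ (hx.trans_lt ht.1)
  have hY1 := hY le_rfl one_pos
  rw [pohozaevVariation_zero hε] at hY1
  have hlim : Tendsto (fun t => -((B + 5) * (C * C₂)) *
      (Real.sinh t ^ (ε / (4 + ε)) / Real.sinh t)) atTop (𝓝 0) := by
    simpa using (tendsto_sinh_rpow_div_sinh hε).const_mul (-((B + 5) * (C * C₂)))
  have : 0 ≤ pohozaevVariation A ε u p w r 1 := by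
    refine le_of_tendsto hlim ?_
    filter_upwards [eventually_ge_atTop T, eventually_gt_atTop 1] with t ht h1t
    refine le_trans ?_ (hY zero_le_one h1t).le
    have ht0 := hT.trans_le ht
    have hs := Real.sinh_pos_iff.2 ht0
    have hσ : 0 < Real.sinh t ^ (ε / (4 + ε)) := Real.rpow_pos_of_pos hs _
    have hut := hu t ht0.le
    have hwt := hneg t (hTc ht)
    have hpt := H.snd_neg_of_tendsto hB hε hu h0 ht0
    have hΔt := hΔ ht0
    have hrt := hcase t ht
    have hpu := H.abs_snd_le hA hB hε hu h0 hT₀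
      (fun t ht => ⟨(hdec t ht).1, (hdec t ht).2.1, (hdec t ht).2.2.2⟩) (hTT ht)
    have hpu' : -(B + 5) ≤ p t / u t := by rw [le_div_iff₀ hut]; linarith
    have hsp := (hdec t (hTT ht)).2.2.2
    have hsΔ : Real.sinh t * wronskian u p w r t ≤ C * (C₂ / Real.sinh t) := by
      have e1 : -(Real.sinh t * p t) * -w t ≤ C * (C₂ / Real.sinh t) :=
        mul_le_mul (by linarith) (hwle t ht) (by linarith) hC.le
      have e2 : 0 ≤ Real.sinh t * (u t * r t) := by positivity
      rw [wronskian]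
      linarith
    rw [pohozaevVariation]
    have e3 : 0 ≤ A * ε / (2 + ε) * (Real.sinh t * (-w t * (|u t| ^ ε * u t))) := by
      have : 0 < -w t := by linarith
      positivity
    have e4 : 0 ≤ wronskian u p w r t * (2 / (4 + ε) * Real.cosh t) := by
      have := Real.cosh_pos t
      positivity
    have e5 : -(B + 5) * (C * (C₂ / Real.sinh t)) ≤
        Real.sinh t * wronskian u p w r t * (p t / u t) := by
      have e6 : 0 < Real.sinh t * wronskian u p w r t := by positivity
      calc -(B + 5) * (C * (C₂ / Real.sinh t))
          ≤ -(B + 5) * (Real.sinh t * wronskian u p w r t) :=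
            mul_le_mul_of_nonpos_left hsΔ (by linarith)
        _ = (Real.sinh t * wronskian u p w r t) * -(B + 5) := by ring
        _ ≤ _ := by gcongr
    calc -((B + 5) * (C * C₂)) * (Real.sinh t ^ (ε / (4 + ε)) / Real.sinh t)
        = Real.sinh t ^ (ε / (4 + ε)) * (-(B + 5) * (C * (C₂ / Real.sinh t))) := by ring
      _ ≤ _ := by
          refine mul_le_mul_of_nonneg_left ?_ hσ.le
          linarith
  linarith

end Ground

/-! ### Uniqueness of the ground state -/

section Shooting

variable {A B ε : ℝ} {U P : ℝ → ℝ → ℝ}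

/-- Initial values slightly above that of a ground state lead to solutions with a zero. -/
theorem eventually_exists_nonpos (hA : 0 < A) (hB : 0 < B) (hε : 0 < ε)
    (hU : ∀ a, 0 < a → RadialPair (U a) (P a) fun τ => powerNl A B ε (U a τ))
    (hU0 : ∀ a, 0 < a → U a 0 = a) {α : ℝ} (hα : 0 < α) (hpos : ∀ τ, 0 ≤ τ → 0 < U α τ)
    (hlim : Tendsto (U α) atTop (𝓝 0)) : ∀ᶠ a in 𝓝[>] α, ∃ τ, 0 < τ ∧ U a τ ≤ 0 := by
  have H := hU α hα
  obtain ⟨w, r, W, hw0, hvar⟩ := exists_variation hA hB hε hU hU0 hα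
  obtain ⟨-, hwbot⟩ := H.variation_of_tendsto hA hB hε W (by rw [hw0]) hpos hlim
  obtain ⟨T, C, hT, -, hdec⟩ := H.exists_decay hA hB hε hpos hlim
  obtain ⟨S, hS⟩ := eventually_atTop.1 ((hwbot.eventually_lt_atBot 0).and (eventually_ge_atTop T))
  -- Both w and r negative at t₀ means that, for a slightly above α, U α - U a is positive and
  -- increasing at t₀.
  have hrS : ∃ t, S ≤ t ∧ r t < 0 := by
    by_contra! hcon
    have hge : ∀ t, S ≤ t → w S ≤ w t := fun t ht =>
      le_of_hasDerivAt_nonneg ht (W.1.mono fun x hx => (hT.le.trans (hS S le_rfl).2).trans hx.1)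
        (fun x hx => W.4 x (hT.trans_le (hS x hx.1.le).2)) fun x hx => hcon x hx.1.le
    obtain ⟨t, h1, h2⟩ := ((hwbot.eventually_lt_atBot (w S)).and (eventually_ge_atTop S)).exists
    exact absurd (hge t h2) (not_le.2 h1)
  obtain ⟨t₀, ht₀, hrt₀⟩ := hrS
  obtain ⟨hwt₀, hTt₀⟩ := hS t₀ ht₀
  have ht₀0 : 0 < t₀ := hT.trans_le hTt₀
  have hc : 0 < min (-w t₀) (-r t₀) / 2 :=
    half_pos (lt_min (by linarith) (by linarith))
  filter_upwards [nhdsWithin_le_nhds (hvar t₀ ht₀0.le _ hc), self_mem_nhdsWithin] with a ha hαa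
  have hαa : α < a := hαa
  obtain ⟨h1, h2⟩ := ha t₀ ⟨ht₀0.le, le_rfl⟩
  have hm1 := min_le_left (-w t₀) (-r t₀)
  have hm2 := min_le_right (-w t₀) (-r t₀)
  have hd : 0 < a - α := sub_pos.2 hαa
  rw [abs_of_pos hd] at h1 h2
  have hz0 : 0 < U α t₀ - U a t₀ := by
    have := (abs_le.1 h1).2
    nlinarith
  have hz1 : 0 < P α t₀ - P a t₀ := by
    have := (abs_le.1 h2).2
    nlinarith
  by_contra! hcon
  have Z := H.sub (hU a (hα.trans hαa))
  -- f is decreasing on (0, U α t] in the tail, so while the gap is positive its equation makes sinh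
  -- times its derivative increase. The gap then never shrinks, yet it lies below U α, which tends
  -- to 0, if U a stays positive.
  have hfmono : ∀ t, t₀ ≤ t → 0 < U α t - U a t →
      powerNl A B ε (U α t) < powerNl A B ε (U a t) := by
    intro t ht hlt
    have ht0 := ht₀0.trans_le ht
    have := lt_of_hasDerivAt_pos (g := fun x => -powerNl A B ε x) (sub_pos.1 hlt)
      (continuous_powerNl hε).neg.continuousOn (fun x _ => (hasDerivAt_powerNl hε x).neg)
      (fun x hx => by
        have hx0 : 0 < x := (hcon t ht0).trans hx.1
        have h3 : |x| ^ ε ≤ |U α t| ^ ε := by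
          refine Real.rpow_le_rpow (abs_nonneg _) ?_ hε.le
          rw [abs_of_pos hx0, abs_of_pos (hpos t ht0.le)]
          exact hx.2.le
        have h4 := (hdec t (hTt₀.trans ht)).2.1
        have h5 : A * (1 + ε) * |x| ^ ε ≤ A * (1 + ε) * |U α t| ^ ε := by gcongr
        rw [powerNlDeriv]
        linarith)
    linarith
  have hzge : ∀ t, t₀ ≤ t → (∀ x ∈ Ioo t₀ t, 0 ≤ P α x - P a x) →
      U α t₀ - U a t₀ ≤ U α t - U a t := fun t ht hx =>
    le_of_hasDerivAt_nonneg (g := fun t => U α t - U a t) ht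
      (Z.1.mono fun x hx => ht₀0.le.trans hx.1) (fun x hx => Z.4 x (ht₀0.trans hx.1)) hx
  have hPpos : ∀ t, t₀ ≤ t → 0 < Real.sinh t * (P α t - P a t) := by
    intro t ht
    by_contra hneg
    obtain ⟨e, he, hge, hlt⟩ := exists_first_zero ht
      (Z.continuousOn_sinh_mul.mono fun x hx => ht₀0.le.trans hx.1)
      (mul_pos (Real.sinh_pos_iff.2 ht₀0) hz1) (not_lt.1 hneg)
    have := lt_of_hasDerivAt_pos (g := fun t => Real.sinh t * (P α t - P a t)) he.1
      (Z.continuousOn_sinh_mul.mono fun x hx => ht₀0.le.trans hx.1)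
      (fun x hx => Z.hasDerivAt_sinh_mul (ht₀0.trans hx.1))
      (fun x hx => by
        have hx0 := ht₀0.trans hx.1
        have h3 : U α t₀ - U a t₀ ≤ U α x - U a x := hzge x hx.1.le fun y hy =>
          (pos_of_mul_pos_right (hlt y ⟨hy.1.le, hy.2.trans hx.2⟩)
            (Real.sinh_pos_iff.2 (ht₀0.trans hy.1)).le).le
        have h4 := hfmono x hx.1.le (hz0.trans_le h3)
        have h5 := Real.sinh_pos_iff.2 hx0
        nlinarith)
    simp only [hge] at this
    exact absurd (mul_pos (Real.sinh_pos_iff.2 ht₀0) hz1) (not_lt.2 this.le)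
  obtain ⟨t, h3, h4⟩ := ((hlim.eventually (gt_mem_nhds hz0)).and (eventually_ge_atTop t₀)).exists
  have h5 := hzge t h4 fun x hx => (pos_of_mul_pos_right (hPpos x hx.1.le)
    (Real.sinh_pos_iff.2 (ht₀0.trans hx.1)).le).le
  have h6 := hcon t (ht₀0.trans_le h4)
  linarith

/-- Continuous induction on [a, β], for some a just above α, on the property of reaching a
nonpositive value within the fixed time T. Fixing T is what makes the property closed. -/
theorem not_pos_of_ground_lt (hA : 0 < A) (hB : 0 < B) (hε : 0 < ε)
    (hU : ∀ a, 0 < a → RadialPair (U a) (P a) fun τ => powerNl A B ε (U a τ))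
    (hU0 : ∀ a, 0 < a → U a 0 = a) {α β : ℝ} (hα : 0 < α) (hαβ : α < β)
    (hpos : ∀ τ, 0 ≤ τ → 0 < U α τ) (hlim : Tendsto (U α) atTop (𝓝 0)) :
    ∃ τ, 0 ≤ τ ∧ U β τ ≤ 0 := by
  obtain ⟨a, ⟨T, hT, haT⟩, haβ⟩ :=
    ((eventually_exists_nonpos hA hB hε hU hU0 hα hpos hlim).and (Ioo_mem_nhdsGT hαβ)).exists
  set S : Set ℝ := {x | ∃ τ ∈ Icc 0 T, U x τ ≤ 0} with hSdef
  have ha0 : 0 < a := hα.trans haβ.1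
  suffices h : Icc a β ⊆ S by
    obtain ⟨τ, hτ, h1⟩ := h (right_mem_Icc.2 haβ.2.le)
    exact ⟨τ, hτ.1, h1⟩
  refine IsClosed.Icc_subset_of_forall_mem_nhdsWithin ?_ ⟨T, ⟨hT.le, le_rfl⟩, haT⟩ ?_
  · refine isClosed_of_closure_subset fun x hx => ?_
    have hxI : x ∈ Icc a β :=
      closure_minimal inter_subset_right isClosed_Icc hx
    refine ⟨?_, hxI⟩
    have hx0 : 0 < x := ha0.trans_le hxI.1
    by_contra hxS
    have hxpos : ∀ τ ∈ Icc 0 T, 0 < U x τ := fun τ hτ => by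
      by_contra hneg
      exact hxS ⟨τ, hτ, not_lt.1 hneg⟩
    obtain ⟨τm, hτm, hmin⟩ := isCompact_Icc.exists_isMinOn (nonempty_Icc.2 hT.le)
      ((hU x hx0).1.mono Icc_subset_Ici_self)
    obtain ⟨w, r, W, -, hvar⟩ := exists_variation hA hB hε hU hU0 hx0
    obtain ⟨M, hM⟩ := isCompact_Icc.exists_bound_of_continuousOn (s := Icc (0 : ℝ) T)
      (W.1.mono Icc_subset_Ici_self)
    have hM0 : 0 ≤ M := (norm_nonneg _).trans (hM 0 ⟨le_rfl, hT.le⟩)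
    have hsm : ∀ᶠ y in 𝓝 x, (M + 1) * |y - x| < U x τm := by
      have : Continuous fun y : ℝ => (M + 1) * |y - x| := by fun_prop
      exact this.continuousAt.eventually (gt_mem_nhds (by simpa using hxpos τm hτm))
    obtain ⟨y, ⟨⟨τ, hτ, hyτ⟩, -⟩, h1, h2⟩ :=
      ((mem_closure_iff_frequently.1 hx).and_eventually ((hvar T hT.le 1 one_pos).and hsm)).exists
    have h3 := (h1 τ hτ).1
    have h4 := hM τ hτ
    have h5 : U x τm ≤ U x τ := hmin hτ
    have h6 : |(y - x) * w τ| ≤ M * |y - x| := by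
      rw [abs_mul, mul_comm]
      rw [Real.norm_eq_abs] at h4
      gcongr
    have h7 := (abs_le.1 h3).1
    have h8 := (abs_le.1 h6).1
    linarith
  · rintro x ⟨⟨τ, hτ, hxτ⟩, hxI⟩
    have hx0 : 0 < x := ha0.trans_le hxI.1
    obtain ⟨b, hb, hUb, hlt⟩ := exists_first_zero hτ.1 ((hU x hx0).1.mono Icc_subset_Ici_self)
      (by rw [hU0 x hx0]; exact hx0) hxτ
    obtain ⟨w, r, W, hw0, hvar⟩ := exists_variation hA hB hε hU hU0 hx0
    -- Since w(b) < 0, slightly larger initial values give a negative value at the same b ≤ T.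
    have hwb := ((hU x hx0).variation_of_zero hA hB hε W hw0 hb.1 hlt hUb).2
    filter_upwards [nhdsWithin_le_nhds (hvar b hb.1.le (-w b / 2) (by linarith)),
      self_mem_nhdsWithin] with y hy hxy
    have hd : 0 < y - x := sub_pos.2 hxy
    have h1 := (abs_le.1 (hy b ⟨hb.1.le, le_rfl⟩).1).2
    rw [abs_of_pos hd, hUb] at h1
    exact ⟨b, ⟨hb.1.le, hb.2.trans hτ.2⟩, by nlinarith⟩

end Shooting

/-! ### Classical solutions -/

section Classical

variable {k q γ α : ℝ} {u : ℝ → ℝ}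

/-- The derivative of a classical solution tends to zero at the origin. -/
theorem IsRadialSolution.tendsto_deriv_zero (H : IsRadialSolution k q γ α u) (hkq : 0 < k * q) :
    Tendsto (deriv u) (𝓝[>] 0) (𝓝 0) := by
  have huc : ContinuousOn u (Ici 0) := by
    intro τ hτ
    rcases (mem_Ici.1 hτ).eq_or_lt with h | h
    · rw [← h]; exact H.deriv_init.continuousWithinAt
    · exact (H.differentiable τ h).continuousAt.continuousWithinAt
  have hfc : ContinuousOn (fun t => nonlinearity k q γ (u t)) (Ici 0) :=
    (continuous_powerNl (by positivity)).comp_continuousOn huc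
  obtain ⟨C, hC⟩ := isCompact_Icc.exists_bound_of_continuousOn (s := Icc (0 : ℝ) 1)
    (hfc.mono Icc_subset_Ici_self)
  have hC0 : 0 ≤ C := (norm_nonneg _).trans (hC 0 ⟨le_rfl, zero_le_one⟩)
  have hq : ∀ t, 0 < t → HasDerivAt (fun t => Real.sinh t * deriv u t)
      (-(Real.sinh t * nonlinearity k q γ (u t))) t := by
    intro t ht
    have hs : Real.sinh t ≠ 0 := (Real.sinh_pos_iff.2 ht).ne'
    refine HasDerivAt.congr_deriv ((Real.hasDerivAt_sinh t).mul (H.equation t ht)) ?_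
    field_simp
    ring
  have hslope : Tendsto (fun t => (u t - u 0) / t) (𝓝[>] 0) (𝓝 0) := by
    have h1 := hasDerivWithinAt_iff_tendsto_slope.1 H.deriv_init
    have h2 : Ici (0 : ℝ) \ {0} = Ioi 0 := Ici_sdiff_left
    rw [h2] at h1
    refine h1.congr fun t => ?_
    rw [slope_def_field, sub_zero]
  have hbound : ∀ t ∈ Ioo (0 : ℝ) 1, ‖deriv u t‖ ≤ C * t := by
    intro t ht
    have hs := Real.sinh_pos_iff.2 ht.1
    refine le_of_forall_pos_le_add fun η hη => ?_
    have hev : ∀ᶠ x in 𝓝[>] (0 : ℝ), |(u x - u 0) / x| < η := by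
      have := hslope.abs
      rw [abs_zero] at this
      exact this.eventually (gt_mem_nhds hη)
    obtain ⟨x, hx1, hx⟩ := (hev.and (Ioo_mem_nhdsGT ht.1)).exists
    -- The one-sided derivative yields points ξ arbitrarily near 0 with |u'(ξ)| < η. Integrating
    -- (sinh · u')' from ξ to t then bounds u'(t) by Ct + η.
    obtain ⟨ξ, hξ, hξe⟩ := exists_deriv_eq_slope u hx.1
      (huc.mono Icc_subset_Ici_self) fun y hy =>
        (H.differentiable y hy.1).differentiableWithinAt
    rw [sub_zero] at hξe
    rw [← hξe] at hx1
    have hξt : ξ ≤ t := (hξ.2.trans hx.2).le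
    have h1 := (convex_Icc ξ t).norm_image_sub_le_of_norm_hasDerivWithin_le
      (f := fun t => Real.sinh t * deriv u t) (C := Real.sinh t * C)
      (fun y hy => (hq y (hξ.1.trans_le hy.1)).hasDerivWithinAt)
      (fun y hy => by
        have hy0 := hξ.1.trans_le hy.1
        have hsy := Real.sinh_pos_iff.2 hy0
        rw [norm_neg, norm_mul, Real.norm_eq_abs, abs_of_pos hsy]
        have := Real.sinh_le_sinh.2 hy.2
        have := hC y ⟨hy0.le, (hy.2.trans ht.2.le)⟩
        gcongr)
      (left_mem_Icc.2 hξt) (right_mem_Icc.2 hξt)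
    rw [Real.norm_eq_abs, Real.norm_eq_abs, abs_of_nonneg (sub_nonneg.2 hξt)] at h1
    have h2 : |Real.sinh t * deriv u t| ≤ Real.sinh t * C * t + Real.sinh t * η := by
      have h3 := abs_sub_abs_le_abs_sub (Real.sinh t * deriv u t) (Real.sinh ξ * deriv u ξ)
      have h4 : |Real.sinh ξ * deriv u ξ| ≤ Real.sinh t * η := by
        rw [abs_mul, abs_of_pos (Real.sinh_pos_iff.2 hξ.1)]
        have := Real.sinh_le_sinh.2 hξt
        gcongr
      have h5 : Real.sinh t * C * (t - ξ) ≤ Real.sinh t * C * t := by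
        have := hξ.1.le
        gcongr
        linarith
      linarith
    rw [abs_mul, abs_of_pos hs] at h2
    rw [Real.norm_eq_abs]
    refine le_of_mul_le_mul_left ?_ hs
    linarith
  refine squeeze_zero_norm' (by
    filter_upwards [Ioo_mem_nhdsGT zero_lt_one] with t ht using hbound t ht) ?_
  have : Continuous fun t : ℝ => C * t := by fun_prop
  simpa using (this.tendsto 0).mono_left nhdsWithin_le_nhds

/-- The two-sided `deriv u 0` depends on the unconstrained values at negative arguments, so the
derivative is reset to 0 there. -/
theorem IsRadialSolution.radialPair (H : IsRadialSolution k q γ α u) (hkq : 0 < k * q) :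
    RadialPair u (fun τ => if τ ≤ 0 then 0 else deriv u τ)
      (fun τ => nonlinearity k q γ (u τ)) := by
  have hev : ∀ τ, 0 < τ → (fun τ => if τ ≤ 0 then 0 else deriv u τ) =ᶠ[𝓝 τ] deriv u := by
    intro τ hτ
    filter_upwards [lt_mem_nhds hτ] with t ht
    rw [if_neg (not_le.2 ht)]
  refine ⟨fun τ hτ => ?_, fun τ hτ => ?_, by simp, fun τ hτ => ?_, fun τ hτ => ?_⟩
  · rcases (mem_Ici.1 hτ).eq_or_lt with h | h
    · rw [← h]; exact H.deriv_init.continuousWithinAt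
    · exact (H.differentiable τ h).continuousAt.continuousWithinAt
  · rcases (mem_Ici.1 hτ).eq_or_lt with h | h
    · rw [← h, ← continuousWithinAt_Ioi_iff_Ici, ContinuousWithinAt, if_pos le_rfl]
      refine (H.tendsto_deriv_zero hkq).congr' ?_
      filter_upwards [self_mem_nhdsWithin] with t ht
      rw [if_neg (not_le.2 ht)]
    · exact ((H.equation τ h).continuousAt.congr (hev τ h).symm).continuousWithinAt
  · rw [if_neg (not_le.2 hτ)]
    exact (H.differentiable τ hτ).hasDerivAt
  · refine HasDerivAt.congr_deriv ((H.equation τ hτ).congr_of_eventuallyEq (hev τ hτ)) ?_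
    rw [if_neg (not_le.2 hτ)]

theorem RadialPair.isRadialSolution {p : ℝ → ℝ}
    (H : RadialPair u p fun τ => nonlinearity k q γ (u τ)) (h0 : u 0 = α) :
    IsRadialSolution k q γ α u := by
  have hd : ∀ τ, 0 < τ → deriv u τ = p τ := fun τ hτ => (H.4 τ hτ).deriv
  have hev : ∀ τ, 0 < τ → deriv u =ᶠ[𝓝 τ] p := fun τ hτ => by
    filter_upwards [lt_mem_nhds hτ] with t ht using hd t ht
  refine ⟨h0, ?_, fun τ hτ => (H.4 τ hτ).differentiableAt, fun τ hτ => ?_⟩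
  · refine hasDerivWithinAt_Ici_of_tendsto_deriv (s := Ioi 0)
      (fun τ hτ => (H.4 τ hτ).differentiableAt.differentiableWithinAt)
      ((H.1 0 self_mem_Ici).mono Ioi_subset_Ici_self) self_mem_nhdsWithin ?_
    have h1 : Tendsto p (𝓝[>] 0) (𝓝 0) := by
      have := (H.2 0 self_mem_Ici).mono Ioi_subset_Ici_self
      rwa [ContinuousWithinAt, H.3] at this
    refine h1.congr' ?_
    filter_upwards [self_mem_nhdsWithin] with t ht using (hd t ht).symm
  · rw [hd τ hτ]
    exact (H.5 τ hτ).congr_of_eventuallyEq (hev τ hτ)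

end Classical

/-! ### Strict admissibility and uniqueness of the ground state. -/

theorem isVariation_of_forall_eventually {U : ℝ → ℝ → ℝ} {α : ℝ} {w : ℝ → ℝ} {I : Set ℝ}
    (hI : I ⊆ Ici 0) (h : ∀ T, 0 ≤ T → ∀ c, 0 < c → ∀ᶠ a in 𝓝 α, ∀ τ ∈ Icc 0 T,
      |U a τ - U α τ - (a - α) * w τ| ≤ c * |a - α|) : IsVariation U α I w := by
  intro τ hτ
  rw [hasDerivAt_iff_isLittleO, Asymptotics.isLittleO_iff]
  intro c hc
  filter_upwards [h τ (hI hτ) c hc] with a ha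
  exact ha τ ⟨hI hτ, le_rfl⟩

theorem theorem5p1 (k q γ : ℝ) (hk : 0 < k) (hq : 0 < q) (hkq : 2 < k * q) (hγ : 0 < γ) :
    -- the initial value problem is well posed, so the family of its solutions exists
    (∀ α : ℝ, 0 < α → ∃ u : ℝ → ℝ, IsRadialSolution k q γ α u ∧
      ∀ v : ℝ → ℝ, IsRadialSolution k q γ α v → EqOn v u (Ici 0)) ∧
    -- every initial value in `G ∪ N` is strictly admissible
    (∀ U : ℝ → ℝ → ℝ, IsSolutionFamily k q γ U →
      (∀ α ∈ groundSet U, StrictlyAdmissibleGround U α) ∧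
      (∀ α ∈ zeroSet U, StrictlyAdmissibleZero U α)) ∧
    -- the ground state is unique
    (∀ u v : ℝ → ℝ, IsGroundState k q γ u → IsGroundState k q γ v → EqOn u v (Ici 0)) := by
  have hkq0 : 0 < k * q := mul_pos hk hq
  have hB : 0 < k * q * (k * q - 2) := mul_pos hkq0 (by linarith)
  have hA : 0 < γ * (k * q * (k * q - 2)) := mul_pos hγ hB
  have hε : 0 < 2 / (k * q) := by positivity
  have huniq : ∀ α u v, IsRadialSolution k q γ α u → IsRadialSolution k q γ α v →
      EqOn u v (Ici 0) := fun α u v hu hv τ hτ =>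
    RadialPair.eq_of_powerNl hA hB hε (hu.radialPair hkq0) (hv.radialPair hkq0)
      (by rw [hu.init, hv.init]) hτ
  have hex : ∀ α, ∃ u, IsRadialSolution k q γ α u := fun α => by
    obtain ⟨u, p, H, h0⟩ := exists_radialPair_powerNl hA hB hε α
    exact ⟨u, RadialPair.isRadialSolution H h0⟩
  refine ⟨fun α _ => ?_, fun U hU => ?_, ?_⟩
  · obtain ⟨u, hu⟩ := hex α
    exact ⟨u, hu, fun v hv => huniq α v u hv hu⟩
  · have hUP := fun a ha => (hU a ha).radialPair hkq0
    have hU0 := fun a ha => (hU a ha).init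
    constructor
    · rintro α ⟨hα, hpos, hlim⟩
      obtain ⟨w, r, W, hw0, hvar⟩ := exists_variation hA hB hε hUP hU0 hα
      exact ⟨w, isVariation_of_forall_eventually subset_rfl fun T hT c hc =>
        (hvar T hT c hc).mono fun a ha τ hτ => (ha τ hτ).1,
        RadialPair.variation_of_tendsto hA hB hε (hUP α hα) W hw0 hpos hlim⟩
    · rintro α ⟨hα, τ, hτ, hUτ⟩
      obtain ⟨b, hb, hUb, hlt⟩ := exists_first_zero hτ.le
        ((hUP α hα).1.mono Icc_subset_Ici_self) (by rw [hU0 α hα]; exact hα) hUτ.le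
      obtain ⟨w, r, W, hw0, hvar⟩ := exists_variation hA hB hε hUP hU0 hα
      exact ⟨b, ⟨hb.1, hUb, fun t h1 h2 => hlt t ⟨h1, h2⟩⟩, w,
        isVariation_of_forall_eventually Icc_subset_Ici_self fun T hT c hc =>
          (hvar T hT c hc).mono fun a ha τ hτ => (ha τ hτ).1,
        RadialPair.variation_of_zero hA hB hε (hUP α hα) W hw0 hb.1 hlt hUb⟩
  · rintro u v ⟨⟨α, hα, hu⟩, hupos, hulim⟩ ⟨⟨β, hβ, hv⟩, hvpos, hvlim⟩
    -- Shooting needs a whole family of solutions; well-posedness identifies u and v with members of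
    -- it on [0, ∞).
    choose U hU using hex
    have hUP := fun a (_ : 0 < a) => (hU a).radialPair hkq0
    have hU0 := fun a (_ : 0 < a) => (hU a).init
    have hcongr : ∀ {a u}, IsRadialSolution k q γ a u → (∀ τ, 0 ≤ τ → 0 < u τ) →
        Tendsto u atTop (𝓝 0) → (∀ τ, 0 ≤ τ → 0 < U a τ) ∧ Tendsto (U a) atTop (𝓝 0) := by
      intro a u hu h1 h2
      have he := huniq a u (U a) hu (hU a)
      refine ⟨fun τ hτ => he hτ ▸ h1 τ hτ, h2.congr' ?_⟩
      filter_upwards [eventually_ge_atTop 0] with t ht using he ht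
    obtain ⟨hUα, hUαlim⟩ := hcongr hu hupos hulim
    obtain ⟨hUβ, hUβlim⟩ := hcongr hv hvpos hvlim
    rcases lt_trichotomy α β with h | h | h
    · obtain ⟨τ, hτ, hle⟩ := not_pos_of_ground_lt hA hB hε hUP hU0 hα h hUα hUαlim
      exact absurd (hUβ τ hτ) (not_lt.2 hle)
    · exact huniq α u v hu (h ▸ hv)
    · obtain ⟨τ, hτ, hle⟩ := not_pos_of_ground_lt hA hB hε hUP hU0 hβ h hUβ hUβlim
      exact absurd (hUα τ hτ) (not_lt.2 hle)
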